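/- Let $\mathbb M=\mathbb R^d$ and let $\mathcal P_2$ be the set of Borel probability measures on $\mathbb M$ with finite second moment, with the Wasserstein distance $W_2$. Let $\Gamma_0(m,\nu)$ be the set of optimal plans from $m$ to $\nu$ (couplings $\gamma$ of $m,\nu$ with $\int|x-y|^2d\gamma=W_2^2(m,\nu)$). Let $L^2(m)$ be the Hilbert space of square-integrable vector fields on $\mathbb M$, with norm $\|\cdot\|_m$, and let $T_m$ be the closure in $L^2(m)$ of $\nabla C_c^\infty(\mathbb M)$. For $U:\mathcal P_2\to[-\infty,\infty]$ and $m$ with $U[m]\in\mathbb R$, a field $\zeta\in L^2(m)$ is a subgradient of $U$ at $m$ if $U[\nu]-U[m]\ge\inf_{\gamma\in\Gamma_0(m,\nu)}\int\langle\zeta(x),y-x\rangle\,\gamma(dx,dy)+o(W_2(m,\nu))$, and a supergradient if $-\zeta$ is a subgradient of $-U$ at $m$. $U$ is differentiable at $m$ if $U[m]\in\mathbb R$ and it has both a subgradient and a supergradient at $m$; then $\nabla_wU[m]$ denotes the subgradient of minimal norm, and for a vector field $\zeta$ we set $\zeta\cdot(U[m]):=\int\langle\nabla_wU[m],\zeta\rangle\,dm$.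 If $U$ is differentiable in a neighborhood of $m$ and $\nu\mapsto\zeta\cdot(U[\nu])$ is differentiable at $m$ for every $\zeta\in C_c^\infty(\mathbb M,\mathbb M)$, put, for $\zeta_1,\zeta_2\in\nabla C_c^\infty(\mathbb M)$, $$\overline{\mathrm{Hess}}\,U[m](\zeta_1,\zeta_2)=\zeta_1\cdot\bigl(\zeta_2\cdot(U[m])\bigr)-\bigl(\nabla\zeta_2\,\zeta_1\bigr)\cdot(U[m]).$$ $U$ has a Hessian at $m$ if, moreover, $|\overline{\mathrm{Hess}}\,U[m](\zeta_1,\zeta_2)|\le C\|\zeta_1\|_m\|\zeta_2\|_m$ for some constant $C$; then $\mathrm{Hess}\,U[m]$ is the unique bounded bilinear extension of $\overline{\mathrm{Hess}}\,U[m]$ to $T_m\times T_m$. **Theorem.** Let $U:\mathcal P_2\to[-\infty,\infty]$ and let $m\in\mathcal P_2$ with $U[m]\in\mathbb R$. Suppose that there are a $W_2$-ball $B$ centered at $m$ and a constant $C_m$ such that, for every $\nu\in B$, $U$ is differentiable at $\nu$ and $\nabla_wU[\nu]$ has a continuous representative, again denoted $\nabla_wU[\nu]$, with $|\nabla_wU[\nu](x)|\le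 C_m(1+|x|)$ for all $x\in\mathbb M$. Let $\rho,\epsilon_2:[0,\infty)\to[0,\infty)$ satisfy $\lim_{t\to0^+}\rho(t)=\lim_{t\to0^+}\epsilon_2(t)=0$, where $\rho$ is concave, continuous, nondecreasing and subadditive with $\rho(0)=0$. Let $\tilde A[m]:\mathbb M\to\mathbb R^{d\times d}$ and $A_{mm}:\mathbb M^2\to\mathbb R^{d\times d}$ be bounded Borel functions such that, for all $\nu\in B$, all $\gamma\in\Gamma_0(m,\nu)$ and all $x,y\in\mathbb M$, $$\Bigl|\nabla_wU[\nu](y)-\nabla_wU[m](x)-\tilde A[m](x)(y-x)-\int_{\mathbb M^2}A_{mm}(x,a)(b-a)\,\gamma(da,db)\Bigr|\le|x-y|\,\rho(|x-y|)+W_2(m,\nu)\,\epsilon_2\bigl(W_2(m,\nu)\bigr).$$ Then $U$ has a Hessian at $m$, and for all $\zeta_1,\zeta_2\in T_m$ $$\mathrm{Hess}\,U[m](\zeta_1,\zeta_2)=\int_{\mathbb M}\langle\tilde A[m](x)\zeta_1(x),\zeta_2(x)\rangle\,m(dx)+\int_{\mathbb M^2}\langle A_{mm}(x,a)\zeta_1(a),\zeta_2(x)\rangle\,m(dx)\,m(da).$$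 -/

import Mathlib

open MeasureTheory Set Filter Topology
open scoped ContDiff Gradient RealInnerProductSpace ENNReal

noncomputable section

namespace Wass

/-- The Euclidean space `ℝ^d`. -/
abbrev M (d : ℕ) : Type := EuclideanSpace ℝ (Fin d)

/-- Borel probability measures on `ℝ^d` with finite second moment. -/
abbrev P2 (d : ℕ) : Type :=
  {μ : Measure (M d) // IsProbabilityMeasure μ ∧ MemLp (fun x : M d => x) 2 μ}

variable {d : ℕ}

instance (m : P2 d) : IsProbabilityMeasure m.1 := m.2.1

/-- The set `Γ(m, ν)` of transport plans from `m` to `ν`. -/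
def plans (m ν : P2 d) : Set (Measure (M d × M d)) :=
  {γ | γ.map Prod.fst = m.1 ∧ γ.map Prod.snd = ν.1}

/-- The quadratic cost `∫ |x - y|² dγ` of a plan. -/
def cost (γ : Measure (M d × M d)) : ℝ := ∫ p, ‖p.1 - p.2‖ ^ 2 ∂γ

/-- The Wasserstein distance `W₂`. -/
def W2 (m ν : P2 d) : ℝ := Real.sqrt (sInf (cost '' plans m ν))

/-- The set `Γ₀(m, ν)` of optimal plans from `m` to `ν`. -/
def optPlans (m ν : P2 d) : Set (Measure (M d × M d)) :=
  {γ | γ ∈ plans m ν ∧ W2 m ν ^ 2 = cost γ}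

/-- The Hilbert space `L²(m)` of vector fields on `ℝ^d` (modulo equality `m`-almost everywhere). -/
abbrev L2 (m : P2 d) : Type := Lp (M d) 2 m.1

/-- The set of `m` at which `U` takes a real value. -/
def dom (U : P2 d → EReal) : Set (P2 d) := {m | U m ≠ ⊤ ∧ U m ≠ ⊥}

/-- The subdifferential `∂_. U[m]`, for `m ∈ dom U`: all `ζ ∈ L²(m)` with
`U[ν] - U[m] ≥ inf_{γ ∈ Γ₀(m, ν)} ∫ ζ(x) · (y - x) dγ + o(W₂(m, ν))`. -/
def subdiff (U : P2 d → EReal) (m : P2 d) : Set (L2 m) :=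
  {ζ | ∀ ε : ℝ, 0 < ε → ∃ δ : ℝ, 0 < δ ∧ ∀ ν : P2 d, W2 m ν < δ →
    (((U m).toReal + sInf ((fun γ : Measure (M d × M d) => ∫ p, ⟪ζ p.1, p.2 - p.1⟫ ∂γ) ''
      optPlans m ν) - ε * W2 m ν : ℝ) : EReal) ≤ U ν}

/-- The superdifferential: `ζ ∈ ∂^. U[m]` means `-ζ ∈ ∂_. (-U)[m]`. -/
def superdiff (U : P2 d → EReal) (m : P2 d) : Set (L2 m) :=
  {ζ | -ζ ∈ subdiff (fun ν => -U ν) m}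

/-- `U` is differentiable at `m`: `m ∈ dom U`, and both the sub- and the superdifferential at `m`
are nonempty. -/
def DiffAt (U : P2 d → EReal) (m : P2 d) : Prop :=
  m ∈ dom U ∧ (subdiff U m).Nonempty ∧ (superdiff U m).Nonempty

/-- `ξ` is an element of minimal norm of the subdifferential of `U` at `m`. -/
def IsMinSubgradient (U : P2 d → EReal) (m : P2 d) (ξ : L2 m) : Prop :=
  ξ ∈ subdiff U m ∧ ∀ ζ ∈ subdiff U m, ‖ξ‖ ≤ ‖ζ‖

open Classical in
/-- The Wasserstein gradient `∇_w U[m]`: the element of minimal norm of the subdifferential (and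
`0` if there is none). -/
def wGrad (U : P2 d → EReal) (m : P2 d) : L2 m :=
  if h : ∃ ξ : L2 m, IsMinSubgradient U m ξ then h.choose else 0

/-- The directional derivative `ζ · (U[m]) = ⟨∇_w U[m]; ζ⟩_m`. -/
def dirDeriv (U : P2 d → EReal) (ζ : M d → M d) (m : P2 d) : ℝ :=
  ∫ x, ⟪wGrad U m x, ζ x⟫ ∂m.1

/-- The function `ν ↦ ζ · (U[ν])`. -/
def dirDerivFun (U : P2 d → EReal) (ζ : M d → M d) : P2 d → EReal :=
  fun ν => ((dirDeriv U ζ ν : ℝ) : EReal)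

/-- The test functions `C_c^∞(ℝ^d)`. -/
abbrev TestFn (d : ℕ) : Type := {φ : M d → ℝ // ContDiff ℝ ∞ φ ∧ HasCompactSupport φ}

theorem contDiff_gradient (φ : TestFn d) : ContDiff ℝ ∞ (∇ φ.1) := by
  have h : ContDiff ℝ ∞ (fderiv ℝ φ.1) := φ.2.1.fderiv_right (by simp)
  exact (InnerProductSpace.toDual ℝ (M d)).symm.toContinuousLinearEquiv.contDiff.comp h

theorem hasCompactSupport_gradient (φ : TestFn d) : HasCompactSupport (∇ φ.1) := by
  have h : HasCompactSupport (fderiv ℝ φ.1) := φ.2.2.fderiv (𝕜 := ℝ)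
  exact h.comp_left (g := (InnerProductSpace.toDual ℝ (M d)).symm) (map_zero _)

theorem memLp_gradient (φ : TestFn d) (m : P2 d) : MemLp (∇ φ.1) 2 m.1 :=
  (contDiff_gradient φ).continuous.memLp_of_hasCompactSupport (hasCompactSupport_gradient φ)

/-- The gradient `∇φ` of a test function as an element of `L²(m)`. -/
def gradL2 (m : P2 d) (φ : TestFn d) : L2 m := (memLp_gradient φ m).toLp (∇ φ.1)

/-- The tangent space `T_m`: the closure of `∇C_c^∞(ℝ^d)` in `L²(m)`. -/
def tangent (m : P2 d) : Submodule ℝ (L2 m) :=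
  (Submodule.span ℝ (Set.range (gradL2 m))).topologicalClosure

/-- The gradient `∇φ` of a test function as an element of `T_m`. -/
def gradT (m : P2 d) (φ : TestFn d) : tangent m :=
  ⟨gradL2 m φ, Submodule.le_topologicalClosure _ (Submodule.subset_span ⟨φ, rfl⟩)⟩

/-- `ζ₁ · (ζ₂ · (U[m])) - (∇ζ₂ ζ₁) · (U[m])` for vector fields `ζ₁`, `ζ₂`. -/
def hessBar (U : P2 d → EReal) (m : P2 d) (ζ₁ ζ₂ : M d → M d) : ℝ :=
  dirDeriv (dirDerivFun U ζ₂) ζ₁ m - dirDeriv U (fun x => fderiv ℝ ζ₂ x (ζ₁ x)) m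

/-- `U` has a Hessian at `m`. -/
structure HasHessianAt (U : P2 d → EReal) (m : P2 d) : Prop where
  diff_near : ∃ r : ℝ, 0 < r ∧ ∀ ν : P2 d, W2 m ν < r → DiffAt U ν
  diff_dirDeriv : ∀ ζ : M d → M d, ContDiff ℝ ∞ ζ → HasCompactSupport ζ →
    DiffAt (dirDerivFun U ζ) m
  bounded : ∃ C : ℝ, ∀ φ₁ φ₂ : TestFn d,
    |hessBar U m (∇ φ₁.1) (∇ φ₂.1)| ≤ C * ‖gradL2 m φ₁‖ * ‖gradL2 m φ₂‖

/-- The bounded bilinear form `H` on `T_m` extends `hessBar U m`. -/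
def ExtendsHessBar (U : P2 d → EReal) (m : P2 d)
    (H : tangent m →L[ℝ] tangent m →L[ℝ] ℝ) : Prop :=
  ∀ φ₁ φ₂ : TestFn d, H (gradT m φ₁) (gradT m φ₂) = hessBar U m (∇ φ₁.1) (∇ φ₂.1)

open Classical in
/-- The Wasserstein Hessian `Hess U[m]`: the bounded bilinear form on `T_m` that extends
`hessBar U m` (and `0` if there is none). -/
def hess (U : P2 d → EReal) (m : P2 d) : tangent m →L[ℝ] tangent m →L[ℝ] ℝ :=
  if h : ∃ H, ExtendsHessBar U m H then h.choose else 0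

theorem dense_span_gradT (m : P2 d) :
    Dense (Submodule.span ℝ (Set.range (gradT m)) : Set (tangent m)) := by
  intro x
  rw [Topology.IsInducing.subtypeVal.closure_eq_preimage_closure_image]
  have h : ((Subtype.val : tangent m → L2 m) ''
      (Submodule.span ℝ (Set.range (gradT m)) : Set (tangent m))) =
      (Submodule.span ℝ (Set.range (gradL2 m)) : Set (L2 m)) := by
    have h1 := Submodule.map_span (tangent m).subtype (Set.range (gradT m))
    have h2 : (tangent m).subtype '' Set.range (gradT m) = Set.range (gradL2 m) := by
      rw [← Set.range_comp]; rfl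
    rw [h2] at h1
    rw [← h1]; rfl
  have hx : (x : L2 m) ∈
      closure (Submodule.span ℝ (Set.range (gradL2 m)) : Set (L2 m)) := x.2
  rw [← h] at hx
  exact hx

/-- There is at most one extension, so that `hess U m` does not depend on a choice. -/
theorem ExtendsHessBar.unique {U : P2 d → EReal} {m : P2 d}
    {H H' : tangent m →L[ℝ] tangent m →L[ℝ] ℝ} (h : ExtendsHessBar U m H)
    (h' : ExtendsHessBar U m H') : H = H' := by
  refine ContinuousLinearMap.ext_on (dense_span_gradT m) ?_
  rintro _ ⟨φ₁, rfl⟩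
  refine ContinuousLinearMap.ext_on (dense_span_gradT m) ?_
  rintro _ ⟨φ₂, rfl⟩
  rw [h φ₁ φ₂, h' φ₁ φ₂]

/-- A modulus: continuous, nondecreasing, subadditive on `[0, ∞)`, and zero at `0`. -/
structure IsModulus (ρ : ℝ → ℝ) : Prop where
  continuousOn : ContinuousOn ρ (Ici 0)
  monotoneOn : MonotoneOn ρ (Ici 0)
  subadditive : ∀ s t : ℝ, 0 ≤ s → 0 ≤ t → ρ (s + t) ≤ ρ s + ρ t
  map_zero : ρ 0 = 0

/-- `P_γ[m](x, y) = Ã(x)(y - x) + ∫ A_{mm}(x, a)(b - a) γ(da, db)`. -/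
def expansion (At : M d → M d →L[ℝ] M d) (Amm : M d → M d → M d →L[ℝ] M d)
    (γ : Measure (M d × M d)) (x y : M d) : M d :=
  At x (y - x) + ∫ p, Amm x p.1 (p.2 - p.1) ∂γ

end Wass

end

/-! For a test field `ζ` put `F ν = ζ · (U[ν]) = ∫ ⟨A ν, ζ⟩ dν`. Along an optimal plan, a product
rule and the hypothesis on `A ν y - A m x` give `F ν - F m = ∫ ⟨g x, y - x⟩ dγ + o(W₂)` with `g =
(∇ζ)ᵀ A m + Ãᵀ ζ + ∫ A_mm(z, ·)ᵀ ζ(z) m(dz)` (`isStrongGradient_of_expansion`). The remainder is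
uniform over optimal plans, so `g` is both a subgradient and a supergradient of `F`. When `g`, built
from `ζ₂`, is paired with `ζ₁`, its first term yields exactly `(∇ζ₂ ζ₁) · (U[m])`, which the
definition of the Hessian subtracts. The rest is the asserted form; it is bounded because `Ã` and
`A_mm` are, so it is the extension.

The derivative of `F` is however defined by its subgradient of minimal norm, not by `g`. Two facts
bridge the gap.

All subgradients of `F` have the same pairing with `∇φ` (`integral_inner_gradient_eq`). For small `t
> 0`, every optimal plan from `m` to its image under `id + t∇φ` is carried by the graph of that map
(`exists_unique_transport`). The infimum in the definition of a subgradient is then over a single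
number, and comparison with the expansion to first order in `t` gives the claim.

A subgradient of minimal norm exists: the projection of `g` onto `T_m`. This requires that a field
`h` orthogonal to gradients satisfy `∫ ⟨h(x), y - x⟩ dγ = 0` for every optimal `γ`
(`integral_inner_displacement_eq_zero`). As `m` is arbitrary, `γ` need not come from a map. But its
support is cyclically monotone, so the part with `‖y‖ ≤ R` lies in the subdifferential of a
Lipschitz convex `ψ`. Moving `x` along a smooth approximation of `th` bounds `t ∫ ⟨y, h⟩` by the
mean increase of `ψ`, up to errors. Mollifying `ψ` and using orthogonality shows that this increase
is at most `o(t)` plus the approximation error (`integral_convex_perturbation_le`). -/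

namespace Wass

/-! ### Transport plans, their marginals and the Wasserstein distance -/

variable {d : ℕ} {m ν : P2 d} {γ : Measure (M d × M d)}

theorem isProbabilityMeasure_of_mem_plans (h : γ ∈ plans m ν) : IsProbabilityMeasure γ := by
  have h1 : IsProbabilityMeasure (γ.map Prod.fst) := by rw [h.1]; infer_instance
  exact Measure.isProbabilityMeasure_of_map Prod.fst

theorem measurePreserving_fst_of_mem_plans (h : γ ∈ plans m ν) :
    MeasurePreserving Prod.fst γ m.1 := ⟨measurable_fst, h.1⟩

theorem measurePreserving_snd_of_mem_plans (h : γ ∈ plans m ν) :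
    MeasurePreserving Prod.snd γ ν.1 := ⟨measurable_snd, h.2⟩

theorem memLp_fst (h : γ ∈ plans m ν) : MemLp (fun p : M d × M d => p.1) 2 γ :=
  m.2.2.comp_measurePreserving (measurePreserving_fst_of_mem_plans h)

theorem memLp_snd (h : γ ∈ plans m ν) : MemLp (fun p : M d × M d => p.2) 2 γ :=
  ν.2.2.comp_measurePreserving (measurePreserving_snd_of_mem_plans h)

theorem memLp_displacement (h : γ ∈ plans m ν) :
    MemLp (fun p : M d × M d => p.2 - p.1) 2 γ := (memLp_snd h).sub (memLp_fst h)

theorem memLp_comp_fst (h : γ ∈ plans m ν) {E : Type*} [NormedAddCommGroup E] {f : M d → E}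
    {q : ℝ≥0∞} (hf : MemLp f q m.1) : MemLp (fun p : M d × M d => f p.1) q γ :=
  hf.comp_measurePreserving (measurePreserving_fst_of_mem_plans h)

theorem integral_comp_fst (h : γ ∈ plans m ν) {E : Type*} [NormedAddCommGroup E] [NormedSpace ℝ E]
    {f : M d → E} (hf : AEStronglyMeasurable f m.1) : ∫ p, f p.1 ∂γ = ∫ x, f x ∂m.1 := by
  have h1 := measurePreserving_fst_of_mem_plans h
  rw [← h1.map_eq] at hf ⊢
  exact (integral_map measurable_fst.aemeasurable hf).symm

theorem integral_comp_snd (h : γ ∈ plans m ν) {E : Type*} [NormedAddCommGroup E] [NormedSpace ℝ E]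
    {f : M d → E} (hf : AEStronglyMeasurable f ν.1) : ∫ p, f p.2 ∂γ = ∫ x, f x ∂ν.1 := by
  have h1 := measurePreserving_snd_of_mem_plans h
  rw [← h1.map_eq] at hf ⊢
  exact (integral_map measurable_snd.aemeasurable hf).symm

theorem integrable_inner_of_memLp {α : Type*} [MeasurableSpace α] {μ : Measure α} {f g : α → M d}
    (hf : MemLp f 2 μ) (hg : MemLp g 2 μ) : Integrable (fun x => ⟪f x, g x⟫) μ := by
  refine (hf.norm.integrable_mul hg.norm).mono'
    (hf.aestronglyMeasurable.inner hg.aestronglyMeasurable) (.of_forall fun x => ?_)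
  exact norm_inner_le_norm _ _

theorem integrable_cost (h : γ ∈ plans m ν) :
    Integrable (fun p : M d × M d => ‖p.1 - p.2‖ ^ 2) γ :=
  ((memLp_fst h).sub (memLp_snd h)).integrable_norm_pow (by norm_num)

theorem cost_nonneg (γ : Measure (M d × M d)) : 0 ≤ cost γ :=
  integral_nonneg fun _ => by positivity

theorem prod_mem_plans (m ν : P2 d) : m.1.prod ν.1 ∈ plans m ν := by
  constructor <;> simp

theorem bddBelow_cost (m ν : P2 d) : BddBelow (cost '' plans m ν) :=
  ⟨0, by rintro _ ⟨γ, -, rfl⟩; exact cost_nonneg γ⟩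

theorem W2_nonneg (m ν : P2 d) : 0 ≤ W2 m ν := Real.sqrt_nonneg _

theorem W2_sq (m ν : P2 d) : W2 m ν ^ 2 = sInf (cost '' plans m ν) :=
  Real.sq_sqrt (Real.sInf_nonneg (by rintro _ ⟨γ, -, rfl⟩; exact cost_nonneg γ))

theorem W2_sq_le_cost (h : γ ∈ plans m ν) : W2 m ν ^ 2 ≤ cost γ := by
  rw [W2_sq]; exact csInf_le (bddBelow_cost m ν) ⟨γ, h, rfl⟩

theorem W2_self (m : P2 d) : W2 m m = 0 := by
  have h : m.1.map (fun x => (x, x)) ∈ plans m m := by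
    constructor
    · rw [Measure.map_map (by fun_prop) (by fun_prop)]; exact Measure.map_id
    · rw [Measure.map_map (by fun_prop) (by fun_prop)]; exact Measure.map_id
  have h1 := W2_sq_le_cost h
  have h2 : cost (m.1.map (fun x => (x, x))) = 0 := by
    rw [cost, integral_map (by fun_prop) (by fun_prop)]; simp
  rw [h2] at h1
  exact pow_eq_zero_iff (two_ne_zero) |>.1 (le_antisymm h1 (sq_nonneg _))

/-! ### Existence of optimal plans -/

theorem ofReal_cost (h : γ ∈ plans m ν) :
    ENNReal.ofReal (cost γ) = ∫⁻ p, ENNReal.ofReal (‖p.1 - p.2‖ ^ 2) ∂γ :=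
  ofReal_integral_eq_lintegral_ofReal (integrable_cost h) (.of_forall fun _ => by positivity)

/-- Transport plans, as a set of probability measures, form a compact set. -/
theorem isCompact_plans (m ν : P2 d) :
    IsCompact {π : ProbabilityMeasure (M d × M d) | (π : Measure (M d × M d)) ∈ plans m ν} := by
  set S := {π : ProbabilityMeasure (M d × M d) | (π : Measure (M d × M d)) ∈ plans m ν} with hS
  have htight : IsTightMeasureSet
      {((π : ProbabilityMeasure (M d × M d)) : Measure (M d × M d)) | π ∈ S} := by
    refine IsTightMeasureSet.prodMk ?_ ?_
    · refine (isTightMeasureSet_singleton (μ := m.1)).subset ?_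
      rintro _ ⟨_, ⟨π, hπ, rfl⟩, rfl⟩
      exact hπ.1
    · refine (isTightMeasureSet_singleton (μ := ν.1)).subset ?_
      rintro _ ⟨_, ⟨π, hπ, rfl⟩, rfl⟩
      exact hπ.2
  have hcl : IsClosed S := by
    have h1 : S = {π | π.map (f := Prod.fst) measurable_fst.aemeasurable = ⟨m.1, inferInstance⟩} ∩
        {π | π.map (f := Prod.snd) measurable_snd.aemeasurable = ⟨ν.1, inferInstance⟩} := by
      ext π
      exact ⟨fun h => ⟨Subtype.ext h.1, Subtype.ext h.2⟩,
        fun h => ⟨congrArg Subtype.val h.1, congrArg Subtype.val h.2⟩⟩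
    rw [h1]
    refine IsClosed.inter ?_ ?_
    · exact isClosed_eq (ProbabilityMeasure.continuous_map continuous_fst) continuous_const
    · exact isClosed_eq (ProbabilityMeasure.continuous_map continuous_snd) continuous_const
  rw [← hcl.closure_eq]
  exact isCompact_closure_of_isTightMeasureSet htight

/-- The direct method: a minimising sequence of plans has a weak limit point by compactness, and the
cost, a nonnegative continuous integrand, is lower semicontinuous by the portmanteau theorem. -/
theorem optPlans_nonempty (m ν : P2 d) : (optPlans m ν).Nonempty := by
  have hne : (cost '' plans m ν).Nonempty := ⟨_, _, prod_mem_plans m ν, rfl⟩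
  obtain ⟨u, -, hu, hmem⟩ := exists_seq_tendsto_sInf hne (bddBelow_cost m ν)
  choose π hπ hcost using hmem
  have hprob : ∀ n, IsProbabilityMeasure (π n) := fun n => isProbabilityMeasure_of_mem_plans (hπ n)
  let κs : ℕ → ProbabilityMeasure (M d × M d) := fun n => ⟨π n, hprob n⟩
  obtain ⟨κ, hκ, φ, hφ, hlim⟩ := (isCompact_plans m ν).isSeqCompact (x := κs) hπ
  refine ⟨κ, hκ, ?_⟩
  refine le_antisymm (W2_sq_le_cost hκ) ?_
  rw [W2_sq]
  have h1 := lintegral_le_liminf_lintegral_of_forall_isOpen_measure_le_liminf_measure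
    (μ := (κ : Measure (M d × M d))) (μs := fun n => π (φ n))
    (f := fun p : M d × M d => ‖p.1 - p.2‖ ^ 2) (by fun_prop) (fun _ => by positivity)
    (fun G hG => ProbabilityMeasure.le_liminf_measure_open_of_tendsto hlim hG)
  rw [← ofReal_cost hκ] at h1
  simp_rw [← ofReal_cost (hπ _), hcost] at h1
  have h2 : Tendsto (fun n => ENNReal.ofReal (u (φ n))) atTop
      (𝓝 (ENNReal.ofReal (sInf (cost '' plans m ν)))) :=
    ENNReal.tendsto_ofReal (hu.comp hφ.tendsto_atTop)
  rw [h2.liminf_eq] at h1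
  refine (ENNReal.ofReal_le_ofReal_iff ?_).1 h1
  exact Real.sInf_nonneg (by rintro _ ⟨γ, -, rfl⟩; exact cost_nonneg γ)

/-! ### Cyclical monotonicity of optimal plans -/

/-- The gain `∑ ⟨yᵢ, x_{σ i} - xᵢ⟩` of permuting the first coordinates of the points `(xᵢ, yᵢ)`. -/
noncomputable def permGain {d : ℕ} {ι : Type*} [Fintype ι] (σ : Equiv.Perm ι) (z : ι → M d × M d) : ℝ :=
  ∑ i, ⟪(z i).2, (z (σ i)).1 - (z i).1⟫

theorem continuous_permGain {ι : Type*} [Fintype ι] (σ : Equiv.Perm ι) :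
    Continuous (permGain (d := d) σ) := by
  unfold permGain; fun_prop

theorem sum_cost_perm {ι : Type*} [Fintype ι] (σ : Equiv.Perm ι) (z : ι → M d × M d) :
    ∑ i, ‖(z (σ i)).1 - (z i).2‖ ^ 2 = ∑ i, ‖(z i).1 - (z i).2‖ ^ 2 - 2 * permGain σ z := by
  have h1 : ∑ i, ‖(z (σ i)).1‖ ^ 2 = ∑ i, ‖(z i).1‖ ^ 2 :=
    Equiv.sum_comp σ (fun i => ‖(z i).1‖ ^ 2)
  simp_rw [norm_sub_sq_real, permGain, Finset.sum_add_distrib, Finset.sum_sub_distrib, h1,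
    Finset.mul_sum, inner_sub_right, mul_sub, Finset.sum_sub_distrib, real_inner_comm]
  ring

/-- Draw one point from `γ` for each index, independently. If the permutation gained on an event of
positive probability, permuting first coordinates on that event would preserve both marginals and
lower the optimal cost. -/
theorem pi_permGain_pos_eq_zero (hγ : γ ∈ optPlans m ν) {ι : Type*} [Fintype ι]
    (σ : Equiv.Perm ι) :
    Measure.pi (fun _ : ι => γ) {z | 0 < permGain σ z} = 0 := by
  have hprob := isProbabilityMeasure_of_mem_plans hγ.1
  rcases isEmpty_or_nonempty ι with hι | hι
  · simp [permGain]
  by_contra hpos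
  set B : Set (ι → M d × M d) := {z | 0 < permGain σ z} with hB
  have hBm : MeasurableSet B := (isOpen_lt continuous_const (continuous_permGain σ)).measurableSet
  set μ := Measure.pi (fun _ : ι => γ) with hμ
  set Q := μ.restrict B with hQ
  set N : ℝ≥0∞ := (Fintype.card ι : ℝ≥0∞) with hN
  have hN0 : N ≠ 0 := by simp [hN]
  have hNt : N ≠ ⊤ := by simp [hN]
  set e : ι → (ι → M d × M d) → M d × M d := fun i z => z i with he
  set b : ι → (ι → M d × M d) → M d × M d := fun i z => ((z (σ i)).1, (z i).2) with hb
  have hem : ∀ i, Measurable (e i) := fun i => measurable_pi_apply i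
  have hbm : ∀ i, Measurable (b i) := fun i => by simp only [hb]; fun_prop
  have hQle : ∀ i, Q.map (e i) ≤ γ := by
    intro i
    calc Q.map (e i) ≤ μ.map (e i) := Measure.map_mono Measure.restrict_le_self (hem i)
      _ = γ := (measurePreserving_eval (fun _ : ι => γ) i).map_eq
  -- `α` is the mass taken away from `N • γ` and `β` the mass put back. Each of the `N` summands of
  -- `α` is at most `γ`, so `N • γ - α` is a genuine remainder and `N⁻¹` normalises the competitor.
  set α : Measure (M d × M d) := ∑ i, Q.map (e i) with hα
  set β : Measure (M d × M d) := ∑ i, Q.map (b i) with hβ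
  have hαle : α ≤ N • γ := by
    calc α ≤ ∑ _i : ι, γ := Finset.sum_le_sum fun i _ => hQle i
      _ = N • γ := by
        rw [Finset.sum_const, Finset.card_univ, hN, ← Nat.cast_smul_eq_nsmul ℝ≥0∞]
  have hNγ : IsFiniteMeasure (N • γ) := ⟨by simpa using hNt.lt_top⟩
  have hαf : IsFiniteMeasure α := isFiniteMeasure_of_le _ hαle
  set rest := N • γ - α with hrest
  have hra : rest + α = N • γ := Measure.sub_add_cancel_of_le hαle
  have hrle : rest ≤ N • γ := Measure.sub_le
  have hmapsum : ∀ (f : M d × M d → M d), Measurable f → ∀ w : ι → (ι → M d × M d) → M d × M d,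
      (∀ i, Measurable (w i)) → (∑ i, Q.map (w i)).map f = ∑ i, Q.map (f ∘ w i) := by
    intro f hf w hw
    rw [Measure.map_finset_sum hf.aemeasurable]
    exact Finset.sum_congr rfl fun i _ => Measure.map_map hf (hw i)
  have hfst : α.map Prod.fst = β.map Prod.fst := by
    rw [hα, hβ, hmapsum _ measurable_fst _ hem, hmapsum _ measurable_fst _ hbm]
    exact (Equiv.sum_comp σ (fun i => Q.map (Prod.fst ∘ e i))).symm
  have hsnd : α.map Prod.snd = β.map Prod.snd := by
    rw [hα, hβ, hmapsum _ measurable_snd _ hem, hmapsum _ measurable_snd _ hbm]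
    rfl
  have hmarg : ∀ f : M d × M d → M d, Measurable f → α.map f = β.map f →
      (N⁻¹ • (rest + β)).map f = γ.map f := by
    intro f hf hab
    rw [Measure.map_smul, Measure.map_add _ _ hf, ← hab, ← Measure.map_add _ _ hf, hra,
      Measure.map_smul, smul_smul, ENNReal.inv_mul_cancel hN0 hNt, one_smul]
  have hplan : N⁻¹ • (rest + β) ∈ plans m ν :=
    ⟨(hmarg _ measurable_fst hfst).trans hγ.1.1, (hmarg _ measurable_snd hsnd).trans hγ.1.2⟩
  have hcost := W2_sq_le_cost hplan
  rw [hγ.2] at hcost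
  set c : M d × M d → ℝ := fun p => ‖p.1 - p.2‖ ^ 2 with hc
  have hcm : Continuous c := by simp only [hc]; fun_prop
  have hcγ : Integrable c (N • γ) := (integrable_cost hγ.1).smul_measure hNt
  have hcr : Integrable c rest := hcγ.mono_measure hrle
  have hcα : Integrable c α := hcγ.mono_measure hαle
  have hL1 : ∀ i, MemLp (fun z : ι → M d × M d => (z i).1) 2 Q := fun i =>
    ((memLp_fst hγ.1).comp_measurePreserving
      (measurePreserving_eval (fun _ : ι => γ) i)).restrict B
  have hL2 : ∀ i, MemLp (fun z : ι → M d × M d => (z i).2) 2 Q := fun i =>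
    ((memLp_snd hγ.1).comp_measurePreserving
      (measurePreserving_eval (fun _ : ι => γ) i)).restrict B
  have hce : ∀ i, Integrable (fun z => c (e i z)) Q := fun i =>
    ((hL1 i).sub (hL2 i)).integrable_norm_pow (by norm_num)
  have hcb : ∀ i, Integrable (fun z => c (b i z)) Q := fun i =>
    ((hL1 (σ i)).sub (hL2 i)).integrable_norm_pow (by norm_num)
  have hcb' : ∀ i, Integrable c (Q.map (b i)) := fun i =>
    (integrable_map_measure hcm.aestronglyMeasurable (hbm i).aemeasurable).2 (hcb i)
  have hce' : ∀ i, Integrable c (Q.map (e i)) := fun i =>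
    (integrable_map_measure hcm.aestronglyMeasurable (hem i).aemeasurable).2 (hce i)
  have hcβ : Integrable c β := integrable_finsetSum_measure.2 fun i _ => hcb' i
  have hI1 : N.toReal * ∫ p, c p ∂γ = ∫ p, c p ∂rest + ∫ p, c p ∂α := by
    rw [← integral_add_measure hcr hcα, hra, integral_smul_measure, smul_eq_mul]
  have hI2 : N.toReal * cost (N⁻¹ • (rest + β)) = ∫ p, c p ∂rest + ∫ p, c p ∂β := by
    rw [cost, integral_smul_measure, integral_add_measure hcr hcβ, smul_eq_mul, ← mul_assoc,
      ENNReal.toReal_inv, mul_inv_cancel₀ (ENNReal.toReal_ne_zero.2 ⟨hN0, hNt⟩), one_mul]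
  have hαβ : ∫ p, c p ∂α ≤ ∫ p, c p ∂β := by
    have := mul_le_mul_of_nonneg_left hcost (ENNReal.toReal_nonneg (a := N))
    rw [hI2, cost, hI1] at this
    linarith
  have hIα : ∫ p, c p ∂α = ∫ z, ∑ i, c (e i z) ∂Q := by
    rw [integral_finsetSum _ fun i _ => hce i, hα, integral_finsetSum_measure fun i _ => hce' i]
    exact Finset.sum_congr rfl fun i _ =>
      integral_map (hem i).aemeasurable hcm.aestronglyMeasurable
  have hIβ : ∫ p, c p ∂β = ∫ z, ∑ i, c (b i z) ∂Q := by
    rw [integral_finsetSum _ fun i _ => hcb i, hβ, integral_finsetSum_measure fun i _ => hcb' i]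
    exact Finset.sum_congr rfl fun i _ =>
      integral_map (hbm i).aemeasurable hcm.aestronglyMeasurable
  have hgain : Integrable (permGain σ) Q := by
    have h1 : permGain σ = fun z => (∑ i, c (e i z) - ∑ i, c (b i z)) / 2 := by
      ext z
      have := sum_cost_perm σ z
      simp only [hc, he, hb]
      linarith
    rw [h1]
    exact ((integrable_finsetSum _ fun i _ => hce i).sub
      (integrable_finsetSum _ fun i _ => hcb i)).div_const 2
  have hle : ∫ z, permGain σ z ∂Q ≤ 0 := by
    have h1 : ∫ z, ∑ i, c (b i z) ∂Q = ∫ z, ∑ i, c (e i z) ∂Q - 2 * ∫ z, permGain σ z ∂Q := by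
      rw [← integral_const_mul, ← integral_sub (integrable_finsetSum _ fun i _ => hce i)
        (hgain.const_mul 2)]
      exact integral_congr_ae (.of_forall fun z => sum_cost_perm σ z)
    rw [hIα, hIβ, h1] at hαβ
    linarith
  have hpos' : 0 < ∫ z, permGain σ z ∂Q := by
    rw [hQ, setIntegral_pos_iff_support_of_nonneg_ae
      ((ae_restrict_iff' hBm).2 (.of_forall fun z hz => le_of_lt hz)) hgain]
    have h1 : Function.support (permGain σ) ∩ B = B :=
      inter_eq_right.2 fun z hz => (ne_of_gt hz : permGain σ z ≠ 0)
    rw [h1]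
    exact pos_iff_ne_zero.2 hpos
  linarith

/-- The support of an optimal plan is cyclically monotone. -/
theorem permGain_nonpos_of_mem_support (hγ : γ ∈ optPlans m ν) {ι : Type*} [Fintype ι]
    (σ : Equiv.Perm ι) (z : ι → M d × M d) (hz : ∀ i, z i ∈ γ.support) : permGain σ z ≤ 0 := by
  have hprob := isProbabilityMeasure_of_mem_plans hγ.1
  by_contra! hpos
  -- An open box around `z` on which the gain is positive has product measure zero. Hence one of its
  -- sides is null, although it is a neighbourhood of a point of the support.
  obtain ⟨u, hu, hsub⟩ := isOpen_pi_iff'.1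
    (isOpen_lt continuous_const (continuous_permGain (d := d) σ)) z hpos
  have h0 := measure_mono_null hsub (pi_permGain_pos_eq_zero hγ σ)
  rw [Measure.pi_pi, Finset.prod_eq_zero_iff] at h0
  obtain ⟨i, -, hi⟩ := h0
  exact ((Measure.mem_support_iff_forall (z i)).1 (hz i) (u i)
    ((hu i).1.mem_nhds (hu i).2)).ne' hi

/-! ### Rockafellar potentials and their mollification -/

/-- The affine function of `x` attached to a chain of `n + 1` points in Rockafellar's
construction. -/
noncomputable def chainValue {d : ℕ} (z : ℕ → M d × M d) (n : ℕ) (x : M d) : ℝ :=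
  ∑ i ∈ Finset.range n, ⟪(z i).2, (z (i + 1)).1 - (z i).1⟫ + ⟪(z n).2, x - (z n).1⟫

theorem chainValue_sub (z : ℕ → M d × M d) (n : ℕ) (x y : M d) :
    chainValue z n x - chainValue z n y = ⟪(z n).2, x - y⟫ := by
  simp only [chainValue, inner_sub_right]; ring

/-- Evaluated at its own starting point, a chain closes up to a cycle. Cyclical monotonicity thereby
bounds all chains at the base point. -/
theorem chainValue_eq_permGain (z : ℕ → M d × M d) (n : ℕ) :
    chainValue z n (z 0).1 = permGain (finRotate (n + 1)) (fun i : Fin (n + 1) => z i) := by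
  rw [permGain, Fin.sum_univ_castSucc, chainValue, Finset.sum_range]
  congr 1
  · refine Finset.sum_congr rfl fun i _ => ?_
    rw [finRotate_apply, Fin.coeSucc_eq_succ]
    simp
  · rw [finRotate_last]; simp

theorem chainValue_snoc (z : ℕ → M d × M d) (n : ℕ) (p : M d × M d) (x : M d) :
    chainValue (fun i => if i ≤ n then z i else p) (n + 1) x =
      chainValue z n p.1 + ⟪p.2, x - p.1⟫ := by
  have h : ∀ i ∈ Finset.range n,
      ⟪(if i ≤ n then z i else p).2,
        (if i + 1 ≤ n then z (i + 1) else p).1 - (if i ≤ n then z i else p).1⟫ =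
      ⟪(z i).2, (z (i + 1)).1 - (z i).1⟫ := by
    intro i hi
    have := Finset.mem_range.1 hi
    rw [if_pos (by omega), if_pos (by omega)]
  simp only [chainValue, Finset.sum_range_succ, Finset.sum_congr rfl h]
  simp

/-- Rockafellar's theorem for a cyclically monotone set with bounded second coordinates. -/
theorem exists_convex_potential (Γ : Set (M d × M d)) (R : NNReal) (hR : ∀ p ∈ Γ, ‖p.2‖ ≤ R)
    (hΓ : ∀ (n : ℕ) (σ : Equiv.Perm (Fin n)) (z : Fin n → M d × M d), (∀ i, z i ∈ Γ) →
      permGain σ z ≤ 0) :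
    ∃ ψ : M d → ℝ, ConvexOn ℝ univ ψ ∧ LipschitzWith R ψ ∧
      ∀ p ∈ Γ, ∀ x, ψ p.1 + ⟪p.2, x - p.1⟫ ≤ ψ x := by
  rcases Γ.eq_empty_or_nonempty with rfl | ⟨p₀, hp₀⟩
  · exact ⟨fun _ => 0, convexOn_const 0 convex_univ, LipschitzWith.const' 0, by simp⟩
  -- The potential is the supremum over chains in `Γ` that start at `p₀`; entries of `z` beyond `n`
  -- play no role. All slopes have norm at most `R`, so the bound at `p₀.1` spreads to every `x`,
  -- and the supremum is finite and Lipschitz on the whole space.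
  set S : M d → Set ℝ := fun x =>
    {s | ∃ (z : ℕ → M d × M d) (n : ℕ), z 0 = p₀ ∧ (∀ i, z i ∈ Γ) ∧ s = chainValue z n x} with hS
  have hlip : ∀ (z : ℕ → M d × M d) (n : ℕ), (∀ i, z i ∈ Γ) → ∀ x y,
      chainValue z n x ≤ chainValue z n y + R * dist x y := by
    intro z n hz x y
    have h1 := chainValue_sub z n x y
    have h2 : ⟪(z n).2, x - y⟫ ≤ R * dist x y := by
      rw [dist_eq_norm]
      exact (real_inner_le_norm _ _).trans
        (mul_le_mul_of_nonneg_right (hR _ (hz n)) (norm_nonneg _))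
    linarith
  have hne : ∀ x, (S x).Nonempty := fun x =>
    ⟨_, fun _ => p₀, 0, rfl, fun _ => hp₀, rfl⟩
  have hbdd : ∀ x, BddAbove (S x) := by
    intro x
    refine ⟨R * dist x p₀.1, ?_⟩
    rintro _ ⟨z, n, h0, hz, rfl⟩
    have h1 := hlip z n hz x p₀.1
    have h2 : chainValue z n p₀.1 ≤ 0 := by
      rw [← h0, chainValue_eq_permGain]
      exact hΓ _ _ _ fun i => hz i
    linarith
  have hle : ∀ (z : ℕ → M d × M d) (n : ℕ), z 0 = p₀ → (∀ i, z i ∈ Γ) → ∀ x,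
      chainValue z n x ≤ sSup (S x) := fun z n h0 hz x =>
    le_csSup (hbdd x) ⟨z, n, h0, hz, rfl⟩
  refine ⟨fun x => sSup (S x), ⟨convex_univ, ?_⟩, ?_, ?_⟩
  · intro x _ y _ a b ha hb hab
    refine csSup_le (hne _) ?_
    rintro _ ⟨z, n, h0, hz, rfl⟩
    have h1 := hle z n h0 hz x
    have h2 := hle z n h0 hz y
    have h3 : chainValue z n (a • x + b • y) = a * chainValue z n x + b * chainValue z n y := by
      have hb' : b = 1 - a := by linarith
      subst hb'
      simp only [chainValue, inner_sub_right, inner_add_right, inner_smul_right]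
      ring
    rw [h3]
    simp only [smul_eq_mul]
    gcongr
  · refine LipschitzWith.of_le_add_mul R fun x y => ?_
    refine csSup_le (hne _) ?_
    rintro _ ⟨z, n, h0, hz, rfl⟩
    exact (hlip z n hz x y).trans (by gcongr; exact hle z n h0 hz y)
  · intro p hp x
    -- Appending `p` to a chain that nearly attains `ψ p.1` gives a chain competing at `x`; this is
    -- the subgradient inequality.
    rw [← le_sub_iff_add_le]
    refine csSup_le (hne _) ?_
    rintro _ ⟨z, n, h0, hz, rfl⟩
    rw [le_sub_iff_add_le, ← chainValue_snoc]
    refine hle _ _ (by simp [h0]) (fun i => ?_) x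
    split_ifs
    exacts [hz i, hp]

/-- A Lipschitz convex function is a uniform limit of smooth ones. -/
theorem exists_smooth_convex_approx {ψ : M d → ℝ} {R : NNReal} (hc : ConvexOn ℝ univ ψ)
    (hl : LipschitzWith R ψ) {δ : ℝ} (hδ : 0 < δ) :
    ∃ u : M d → ℝ, ContDiff ℝ ∞ u ∧ ConvexOn ℝ univ u ∧ LipschitzWith R u ∧
      ∀ x, |u x - ψ x| ≤ R * δ := by
  -- Averaging translates of `ψ` against a probability density supported in a ball of radius `δ`
  -- keeps convexity and the Lipschitz constant, and moves values by at most `R * δ`.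
  let φ : ContDiffBump (0 : M d) := ⟨δ / 2, δ, by positivity, by linarith⟩
  set η : M d → ℝ := φ.normed volume with hη
  have hη0 : ∀ t, 0 ≤ η t := fun t => φ.nonneg_normed t
  have hηc : Continuous η := φ.continuous_normed
  have hηs : HasCompactSupport η := φ.hasCompactSupport_normed
  have hηi : Integrable η := hηc.integrable_of_hasCompactSupport hηs
  have hη1 : ∫ t, η t = 1 := φ.integral_normed
  have hψ : Continuous ψ := hl.continuous
  set u : M d → ℝ := convolution η ψ (ContinuousLinearMap.lsmul ℝ ℝ) volume with hu
  have hux : ∀ x, u x = ∫ t, η t * ψ (x - t) := fun x => rfl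
  have hint : ∀ x, Integrable fun t => η t * ψ (x - t) := fun x =>
    (by fun_prop : Continuous fun t => η t * ψ (x - t)).integrable_of_hasCompactSupport
      hηs.mul_right
  refine ⟨u, hηs.contDiff_convolution_left _ φ.contDiff_normed hψ.locallyIntegrable,
    ⟨convex_univ, ?_⟩, ?_, ?_⟩
  · intro x _ y _ a b ha hb hab
    simp only [hux, smul_eq_mul]
    rw [← integral_const_mul, ← integral_const_mul,
      ← integral_add ((hint x).const_mul a) ((hint y).const_mul b)]
    refine integral_mono (hint _) (((hint x).const_mul a).add ((hint y).const_mul b)) fun t => ?_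
    have h1 := hc.2 (mem_univ (x - t)) (mem_univ (y - t)) ha hb hab
    have h2 : a • (x - t) + b • (y - t) = a • x + b • y - t := by
      have : t = a • t + b • t := by rw [← add_smul, hab, one_smul]
      nth_rw 3 [this]
      simp only [smul_sub]; abel
    rw [h2, smul_eq_mul, smul_eq_mul] at h1
    have h3 := mul_le_mul_of_nonneg_left h1 (hη0 t)
    dsimp only
    linarith
  · refine LipschitzWith.of_le_add_mul R fun x y => ?_
    have h1 : u y + R * dist x y = ∫ t, (η t * ψ (y - t) + η t * (R * dist x y)) := by
      rw [integral_add (hint y) (hηi.mul_const _), integral_mul_const, hη1, one_mul, hux]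
    rw [h1, hux]
    refine integral_mono (hint x) ((hint y).add (hηi.mul_const _)) fun t => ?_
    have h2 : ψ (x - t) ≤ ψ (y - t) + R * dist x y := by
      have := hl.le_add_mul (x - t) (y - t)
      rwa [dist_sub_right] at this
    have h3 := mul_le_mul_of_nonneg_left h2 (hη0 t)
    dsimp only
    linarith
  · intro x
    have := φ.dist_normed_convolution_le (μ := volume) (x₀ := x) (g := ψ) (ε := R * δ)
      hψ.aestronglyMeasurable (fun y hy => ?_)
    · rwa [Real.dist_eq] at this
    · refine (hl.dist_le_mul y x).trans ?_
      gcongr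
      exact (Metric.mem_ball.1 hy).le

/-! ### Cauchy-Schwarz inequalities -/

theorem lpNorm_two_sq {α E : Type*} [MeasurableSpace α] {μ : Measure α} [NormedAddCommGroup E]
    {f : α → E} (hf : MemLp f 2 μ) : lpNorm f 2 μ ^ 2 = ∫ x, ‖f x‖ ^ 2 ∂μ := by
  rw [lpNorm_eq_integral_norm_rpow_toReal two_ne_zero ENNReal.ofNat_ne_top hf.aestronglyMeasurable]
  simp only [ENNReal.toReal_ofNat, Real.rpow_two]
  rw [← Real.rpow_natCast, ← Real.rpow_mul (integral_nonneg fun _ => by positivity)]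
  norm_num

theorem integral_norm_mul_norm_le {α E F : Type*} [MeasurableSpace α] {μ : Measure α}
    [NormedAddCommGroup E] [NormedAddCommGroup F] {f : α → E} {g : α → F}
    (hf : MemLp f 2 μ) (hg : MemLp g 2 μ) :
    ∫ x, ‖f x‖ * ‖g x‖ ∂μ ≤ lpNorm f 2 μ * lpNorm g 2 μ := by
  have h := integral_mul_le_Lp_mul_Lq_of_nonneg (μ := μ) (p := 2) (q := 2) .two_two
    (f := fun x => ‖f x‖) (g := fun x => ‖g x‖) (.of_forall fun _ => norm_nonneg _)
    (.of_forall fun _ => norm_nonneg _) (by simpa using hf.norm) (by simpa using hg.norm)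
  rw [lpNorm_eq_integral_norm_rpow_toReal two_ne_zero ENNReal.ofNat_ne_top hf.aestronglyMeasurable,
    lpNorm_eq_integral_norm_rpow_toReal two_ne_zero ENNReal.ofNat_ne_top hg.aestronglyMeasurable]
  simpa using h

theorem integrable_norm_mul_norm {α E F : Type*} [MeasurableSpace α] {μ : Measure α}
    [NormedAddCommGroup E] [NormedAddCommGroup F] {f : α → E} {g : α → F}
    (hf : MemLp f 2 μ) (hg : MemLp g 2 μ) : Integrable (fun x => ‖f x‖ * ‖g x‖) μ :=
  hf.norm.integrable_mul hg.norm

theorem abs_integral_inner_le {α : Type*} [MeasurableSpace α] {μ : Measure α} {f g : α → M d}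
    (hf : MemLp f 2 μ) (hg : MemLp g 2 μ) :
    |∫ x, ⟪f x, g x⟫ ∂μ| ≤ lpNorm f 2 μ * lpNorm g 2 μ := by
  rw [← Real.norm_eq_abs]
  exact (norm_integral_le_of_norm_le (integrable_norm_mul_norm hf hg)
    (.of_forall fun _ => norm_inner_le_norm _ _)).trans (integral_norm_mul_norm_le hf hg)

theorem integral_norm_le_lpNorm {α E : Type*} [MeasurableSpace α] {μ : Measure α}
    [IsProbabilityMeasure μ] [NormedAddCommGroup E] {f : α → E} (hf : MemLp f 2 μ) :
    ∫ x, ‖f x‖ ∂μ ≤ lpNorm f 2 μ := by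
  have h := integral_norm_mul_norm_le hf (memLp_const (1 : ℝ))
  rw [lpNorm_const (by norm_num) (NeZero.ne μ)] at h
  simpa using h

theorem memLp_one_add_norm (m : P2 d) : MemLp (fun x : M d => 1 + ‖x‖) 2 m.1 := by
  have h1 : MemLp (fun _ : M d => (1 : ℝ)) 2 m.1 := memLp_const 1
  have h2 : MemLp (fun x : M d => ‖x‖) 2 m.1 := m.2.2.norm
  exact h1.add h2

/-! ### Orthogonality to gradients of functions of quadratic growth -/

/-- Smooth cutoff functions that increase to `1`. -/
theorem exists_cutoff (d : ℕ) : ∃ (χ : ℕ → M d → ℝ) (D : ℝ), 0 ≤ D ∧ (∀ k, ContDiff ℝ ∞ (χ k)) ∧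
    (∀ k, HasCompactSupport (χ k)) ∧ (∀ k x, |χ k x| ≤ 1) ∧
    (∀ k x, (1 + ‖x‖) * ‖fderiv ℝ (χ k) x‖ ≤ D) ∧
    ∀ x, ∀ᶠ k in atTop, ∀ᶠ y in 𝓝 x, χ k y = 1 := by
  let χ : ContDiffBump (0 : M d) := ⟨1, 2, one_pos, one_lt_two⟩
  have hχd : ContDiff ℝ ∞ (χ : M d → ℝ) := χ.contDiff
  obtain ⟨D, hD⟩ : ∃ D, ∀ x, ‖fderiv ℝ χ x‖ ≤ D :=
    (χ.hasCompactSupport.fderiv (𝕜 := ℝ)).exists_bound_of_continuous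
      (hχd.continuous_fderiv (by simp))
  have hD0 : 0 ≤ D := (norm_nonneg _).trans (hD 0)
  let s : ℕ → ℝ := fun k => ((k : ℝ) + 1)⁻¹
  have hs : ∀ k, 0 < s k := fun k => by positivity
  -- The factor `3` bounds `s k * (1 + ‖x‖)`: one has `s k ≤ 1`, and `s k * ‖x‖ ≤ 2` wherever the
  -- derivative does not vanish.
  refine ⟨fun k x => χ (s k • x), 3 * D, by positivity, fun k => hχd.comp (contDiff_const_smul _),
    fun k => χ.hasCompactSupport.comp_homeomorph (Homeomorph.smulOfNeZero (s k) (hs k).ne'),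
    fun k x => by rw [abs_of_nonneg χ.nonneg]; exact χ.le_one, fun k x => ?_, fun x => ?_⟩
  · have hχk' : fderiv ℝ (fun x => χ (s k • x)) x = s k • fderiv ℝ χ (s k • x) :=
      fderiv_comp_smul (𝕜 := ℝ) (f := (χ : M d → ℝ)) (c := s k) (x := x)
    rw [hχk', norm_smul, Real.norm_of_nonneg (hs k).le]
    by_cases hx : 2 < ‖s k • x‖
    · have : fderiv ℝ χ (s k • x) = 0 := by
        have h1 : s k • x ∉ tsupport χ := by
          rw [χ.tsupport_eq]; simpa using hx
        exact image_eq_zero_of_notMem_tsupport fun h2 => h1 (tsupport_fderiv_subset ℝ h2)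
      rw [this]
      simp only [norm_zero, mul_zero]
      positivity
    · push Not at hx
      rw [norm_smul, Real.norm_of_nonneg (hs k).le] at hx
      have h1 : s k ≤ 1 := inv_le_one_of_one_le₀ (by linarith [(Nat.cast_nonneg k : (0:ℝ) ≤ k)])
      calc (1 + ‖x‖) * (s k * ‖fderiv ℝ χ (s k • x)‖)
          = (s k + s k * ‖x‖) * ‖fderiv ℝ χ (s k • x)‖ := by ring
        _ ≤ 3 * D := mul_le_mul (by linarith) (hD _) (norm_nonneg _) (by norm_num)
  · have hst : Tendsto (fun k : ℕ => s k * ‖x‖) atTop (𝓝 0) := by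
      have := tendsto_one_div_add_atTop_nhds_zero_nat (𝕜 := ℝ)
      simpa [s] using this.mul_const ‖x‖
    filter_upwards [hst.eventually (gt_mem_nhds one_pos)] with k hk
    have hcont : ContinuousAt (fun y : M d => ‖s k • y‖) x := by fun_prop
    have hx1 : ‖s k • x‖ < 1 := by rwa [norm_smul, Real.norm_of_nonneg (hs k).le]
    filter_upwards [hcont.eventually (gt_mem_nhds hx1)] with y hy
    exact χ.one_of_mem_closedBall (by simpa using le_of_lt hy)

theorem aestronglyMeasurable_clm_apply {α : Type*} [MeasurableSpace α] {μ : Measure α}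
    {E : Type*} [NormedAddCommGroup E] [NormedSpace ℝ E]
    {L : α → M d →L[ℝ] E} {h : α → M d} (hL : AEStronglyMeasurable L μ)
    (hh : AEStronglyMeasurable h μ) : AEStronglyMeasurable (fun x => L x (h x)) μ :=
  isBoundedBilinearMap_apply.continuous.comp_aestronglyMeasurable (hL.prodMk hh)

/-- A vector field orthogonal to the gradients of test functions is orthogonal to the gradients
of smooth functions of quadratic growth. -/
theorem integral_fderiv_eq_zero_of_growth {h : M d → M d} (hh : MemLp h 2 m.1)
    (horth : ∀ φ : TestFn d, ∫ x, fderiv ℝ φ.1 x (h x) ∂m.1 = 0)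
    {v : M d → ℝ} (hv : ContDiff ℝ ∞ v) {C : ℝ} (hvC : ∀ x, |v x| ≤ C * (1 + ‖x‖) ^ 2)
    (hdC : ∀ x, ‖fderiv ℝ v x‖ ≤ C * (1 + ‖x‖)) :
    ∫ x, fderiv ℝ v x (h x) ∂m.1 = 0 := by
  have hC : 0 ≤ C := by
    have := (abs_nonneg _).trans (hvC 0)
    simpa using this
  obtain ⟨χ, D, hD0, hχ, hχs, hχ1, hχD, hχlim⟩ := exists_cutoff d
  have hzero : ∀ k, ∫ x, fderiv ℝ (fun y => χ k y * v y) x (h x) ∂m.1 = 0 := fun k =>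
    horth ⟨fun y => χ k y * v y, (hχ k).mul hv, (hχs k).mul_right⟩
  have hprod : ∀ k x w, fderiv ℝ (fun y => χ k y * v y) x w =
      χ k x * fderiv ℝ v x w + v x * fderiv ℝ (χ k) x w := fun k x w => by
    rw [fderiv_fun_mul ((hχ k).differentiable (by simp) x) (hv.differentiable (by simp) x)]
    simp
  -- Against a function of quadratic growth, the weighted bound on the derivative of the cutoff
  -- leaves linear growth. This is square integrable for `m`, so dominated convergence applies after
  -- pairing with `h`.
  have hcut : ∀ k x, |v x| * ‖fderiv ℝ (χ k) x‖ ≤ C * D * (1 + ‖x‖) := fun k x =>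
    calc |v x| * ‖fderiv ℝ (χ k) x‖ ≤ (C * (1 + ‖x‖) ^ 2) * ‖fderiv ℝ (χ k) x‖ :=
          mul_le_mul_of_nonneg_right (hvC x) (norm_nonneg _)
      _ = (C * (1 + ‖x‖)) * ((1 + ‖x‖) * ‖fderiv ℝ (χ k) x‖) := by ring
      _ ≤ (C * (1 + ‖x‖)) * D := mul_le_mul_of_nonneg_left (hχD k x) (by positivity)
      _ = _ := by ring
  have hbound : ∀ k x, ‖fderiv ℝ (fun y => χ k y * v y) x (h x)‖ ≤
      (C + C * D) * (‖(1 + ‖x‖)‖ * ‖h x‖) := by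
    intro k x
    rw [hprod, Real.norm_of_nonneg (by positivity : 0 ≤ 1 + ‖x‖)]
    have h1 : ‖χ k x * fderiv ℝ v x (h x)‖ ≤ (C * (1 + ‖x‖)) * ‖h x‖ := by
      rw [norm_mul]
      calc _ ≤ 1 * (‖fderiv ℝ v x‖ * ‖h x‖) :=
            mul_le_mul (hχ1 k x) (ContinuousLinearMap.le_opNorm _ _) (norm_nonneg _) zero_le_one
        _ ≤ _ := by rw [one_mul]; exact mul_le_mul_of_nonneg_right (hdC x) (norm_nonneg _)
    have h2 : ‖v x * fderiv ℝ (χ k) x (h x)‖ ≤ (C * D * (1 + ‖x‖)) * ‖h x‖ := by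
      rw [norm_mul]
      calc _ ≤ |v x| * (‖fderiv ℝ (χ k) x‖ * ‖h x‖) :=
            mul_le_mul_of_nonneg_left (ContinuousLinearMap.le_opNorm _ _) (abs_nonneg _)
        _ ≤ _ := by rw [← mul_assoc]; exact mul_le_mul_of_nonneg_right (hcut k x) (norm_nonneg _)
    calc _ ≤ _ := norm_add_le _ _
      _ ≤ _ := add_le_add h1 h2
      _ = _ := by ring
  have hlim : Tendsto (fun k => ∫ x, fderiv ℝ (fun y => χ k y * v y) x (h x) ∂m.1) atTop
      (𝓝 (∫ x, fderiv ℝ v x (h x) ∂m.1)) := by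
    refine tendsto_integral_of_dominated_convergence
      (fun x => (C + C * D) * (‖(1 + ‖x‖)‖ * ‖h x‖)) (fun k => ?_) ?_
      (fun k => .of_forall (hbound k)) (.of_forall fun x => ?_)
    · exact aestronglyMeasurable_clm_apply
        (((hχ k).mul hv).continuous_fderiv (by simp)).aestronglyMeasurable hh.aestronglyMeasurable
    · exact (integrable_norm_mul_norm (memLp_one_add_norm m) hh).const_mul _
    · refine tendsto_const_nhds.congr' ?_
      filter_upwards [hχlim x] with k hk
      have hev : (fun y => χ k y * v y) =ᶠ[𝓝 x] v := by
        filter_upwards [hk] with y hy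
        rw [hy, one_mul]
      rw [hev.fderiv_eq]
  simp_rw [hzero] at hlim
  exact (tendsto_nhds_unique tendsto_const_nhds hlim).symm

theorem inner_gradient_eq_fderiv {v : M d → ℝ} (x w : M d) : ⟪∇ v x, w⟫ = fderiv ℝ v x w := by
  rw [gradient, InnerProductSpace.toDual_symm_apply]

/-- The case `v = ‖x‖ ^ 2`, which is why quadratic growth has to be admitted. -/
theorem integral_inner_id_eq_zero {h : M d → M d} (hh : MemLp h 2 m.1)
    (horth : ∀ φ : TestFn d, ∫ x, fderiv ℝ φ.1 x (h x) ∂m.1 = 0) :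
    ∫ x, ⟪h x, x⟫ ∂m.1 = 0 := by
  have hd : ∀ x : M d, fderiv ℝ (fun y : M d => ‖y‖ ^ 2) x = 2 • innerSL ℝ x := fun x =>
    fderiv_norm_sq_apply x
  have h1 := integral_fderiv_eq_zero_of_growth hh horth (v := fun x => ‖x‖ ^ 2)
    (contDiff_norm_sq ℝ) (C := 2) (fun x => ?_) (fun x => ?_)
  · have h2 : ∀ x, fderiv ℝ (fun y : M d => ‖y‖ ^ 2) x (h x) = 2 * ⟪h x, x⟫ := fun x => by
      rw [hd]; simp [real_inner_comm, two_mul, two_smul]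
    simp_rw [h2, integral_const_mul] at h1
    linarith
  · rw [abs_of_nonneg (by positivity)]
    nlinarith [norm_nonneg x]
  · rw [hd, two_smul, ← two_smul ℝ, norm_smul, innerSL_apply_norm]
    norm_num

/-! ### Orthogonality to optimal displacements -/

theorem _root_.ConvexOn.fderiv_apply_sub_le {E : Type*} [NormedAddCommGroup E] [NormedSpace ℝ E]
    {u : E → ℝ} (hc : ConvexOn ℝ univ u) {q : E} (hd : DifferentiableAt ℝ u q) (x : E) :
    fderiv ℝ u q (x - q) ≤ u x - u q := by
  have h1 : ConvexOn ℝ univ (u ∘ AffineMap.lineMap q x) :=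
    hc.comp_affineMap (AffineMap.lineMap q x : ℝ →ᵃ[ℝ] E)
  have h2 : HasDerivAt (u ∘ AffineMap.lineMap q x) (fderiv ℝ u q (x - q)) (0 : ℝ) := by
    refine HasFDerivAt.comp_hasDerivAt (x := (0 : ℝ)) (f := AffineMap.lineMap q x)
      (l := u) (l' := fderiv ℝ u q) ?_ AffineMap.hasDerivAt_lineMap
    simpa using hd.hasFDerivAt
  have h3 := h1.le_slope_of_hasDerivAt (mem_univ _) (mem_univ _) zero_lt_one h2
  simpa [slope_def_field] using h3

theorem _root_.LipschitzWith.abs_sub_le {E : Type*} [SeminormedAddCommGroup E] {f : E → ℝ}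
    {K : NNReal} (hf : LipschitzWith K f) (x y : E) : |f x - f y| ≤ K * ‖x - y‖ := by
  rw [← Real.dist_eq, ← dist_eq_norm]; exact hf.dist_le_mul x y

theorem integrable_lipschitz_perturbation {μ : Measure (M d)} {ψ : M d → ℝ} {R : NNReal}
    (hl : LipschitzWith R ψ) {Z : M d → M d} (hZ : Continuous Z) (hZi : Integrable Z μ) (t : ℝ) :
    Integrable (fun x => ψ (x + t • Z x) - ψ x) μ := by
  refine Integrable.mono' ((hZi.norm.const_mul |t|).const_mul R) ?_ (.of_forall fun x => ?_)
  · have := hl.continuous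
    exact (by fun_prop : Continuous fun x => ψ (x + t • Z x) - ψ x).aestronglyMeasurable
  · refine (hl.abs_sub_le _ _).trans_eq ?_
    rw [add_sub_cancel_left, norm_smul, Real.norm_eq_abs]

/-- A Lipschitz convex function increases, to first order and in the mean, by at most zero along a
field that is orthogonal to gradients. -/
theorem integral_convex_perturbation_le {h : M d → M d} (hh : MemLp h 2 m.1)
    (horth : ∀ φ : TestFn d, ∫ x, fderiv ℝ φ.1 x (h x) ∂m.1 = 0)
    {ψ : M d → ℝ} {R : NNReal} (hc : ConvexOn ℝ univ ψ) (hl : LipschitzWith R ψ)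
    {Z : M d → M d} (hZ : ContDiff ℝ ∞ Z) (hZs : HasCompactSupport Z) {D : ℝ}
    (hD : ∀ x, ‖fderiv ℝ Z x‖ ≤ D) {t : ℝ} (ht : 0 < t) :
    ∫ x, (ψ (x + t • Z x) - ψ x) ∂m.1 ≤
      t * (R * ∫ x, ‖h x - Z x‖ ∂m.1 + t * R * D * ∫ x, ‖h x‖ ∂m.1) := by
  have hD0 : 0 ≤ D := (norm_nonneg _).trans (hD 0)
  have hZL : MemLp Z 2 m.1 := hZ.continuous.memLp_of_hasCompactSupport hZs
  have hhi : Integrable h m.1 := hh.integrable one_le_two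
  have hZi : Integrable Z m.1 := hZL.integrable one_le_two
  obtain ⟨B, hB⟩ := hZs.exists_bound_of_continuous hZ.continuous
  have hB0 : 0 ≤ B := (norm_nonneg _).trans (hB 0)
  refine le_of_forall_pos_le_add fun ε hε => ?_
  -- The mollification error `R * δ` enters twice, at `x` and at `T x`; this choice makes the total
  -- at most `ε`.
  set δ : ℝ := ε / (2 * (R + 1)) with hδ
  have hδ0 : 0 < δ := by positivity
  obtain ⟨u, hu, huc, hul, huψ⟩ := exists_smooth_convex_approx hc hl hδ0
  have hud : Differentiable ℝ u := hu.differentiable (by simp)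
  have hZd : Differentiable ℝ Z := hZ.differentiable (by simp)
  set T : M d → M d := fun x => x + t • Z x with hT
  have hTc : ContDiff ℝ ∞ T := contDiff_id.add (hZ.const_smul t)
  have hTd : ∀ x w, fderiv ℝ T x w = w + t • fderiv ℝ Z x w := fun x w => by
    have h1 : HasFDerivAt T (ContinuousLinearMap.id ℝ (M d) + t • fderiv ℝ Z x) x :=
      (hasFDerivAt_id x).add ((hZd x).hasFDerivAt.const_smul t)
    rw [h1.fderiv]; rfl
  have hvd : ∀ x w, fderiv ℝ (u ∘ T) x w = fderiv ℝ u (T x) (w + t • fderiv ℝ Z x w) := fun x w => by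
    rw [fderiv_comp x (hud _) (hTc.differentiable (by simp) x), ContinuousLinearMap.comp_apply, hTd]
  have hfu : ∀ q, ‖fderiv ℝ u q‖ ≤ R := fun q => norm_fderiv_le_of_lipschitz ℝ hul
  have hfu' : ∀ q w, |fderiv ℝ u q w| ≤ R * ‖w‖ := fun q w =>
    (ContinuousLinearMap.le_opNorm _ _).trans (mul_le_mul_of_nonneg_right (hfu q) (norm_nonneg _))
  have hZw : ∀ x w, ‖t • fderiv ℝ Z x w‖ ≤ t * D * ‖w‖ := fun x w => by
    rw [norm_smul, Real.norm_of_nonneg ht.le, mul_assoc]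
    exact mul_le_mul_of_nonneg_left ((ContinuousLinearMap.le_opNorm _ _).trans
      (mul_le_mul_of_nonneg_right (hD x) (norm_nonneg _))) ht.le
  have hR0 : (0 : ℝ) ≤ R := R.2
  have hvnorm : ∀ x w, ‖fderiv ℝ (u ∘ T) x w‖ ≤ R * (1 + t * D) * ‖w‖ := fun x w => by
    rw [hvd]
    refine (hfu' _ _).trans ?_
    rw [mul_assoc]
    refine mul_le_mul_of_nonneg_left ?_ hR0
    linarith [norm_add_le w (t • fderiv ℝ Z x w), hZw x w]
  set C : ℝ := |u 0| + R * (1 + t * D) + R * (t * B) + R with hC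
  have hC0 : 0 ≤ |u 0| := abs_nonneg _
  have htD : 0 ≤ R * (1 + t * D) := by positivity
  have htB : 0 ≤ R * (t * B) := by positivity
  have hzero : ∫ x, fderiv ℝ (u ∘ T) x (h x) ∂m.1 = 0 := by
    refine integral_fderiv_eq_zero_of_growth hh horth (hu.comp hTc) (C := C) (fun x => ?_)
      (fun x => ?_)
    · have h1 := hul.abs_sub_le (T x) 0
      have h2 : ‖T x - 0‖ ≤ ‖x‖ + t * B := by
        rw [sub_zero]
        refine (norm_add_le _ _).trans ?_
        rw [norm_smul, Real.norm_of_nonneg ht.le]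
        gcongr
        exact hB x
      have h3 : |u (T x)| ≤ |u 0| + R * (‖x‖ + t * B) := by
        have := abs_sub_abs_le_abs_sub (u (T x)) (u 0)
        linarith [mul_le_mul_of_nonneg_left h2 hR0]
      have h4 : |u 0| + R * (‖x‖ + t * B) ≤ C * (1 + ‖x‖) := by
        have := norm_nonneg x
        rw [hC]
        nlinarith [mul_nonneg hC0 this, mul_nonneg htD this, mul_nonneg htB this]
      have h5 : C * (1 + ‖x‖) ≤ C * (1 + ‖x‖) ^ 2 := by
        have h6 : 0 ≤ C := by rw [hC]; positivity
        exact mul_le_mul_of_nonneg_left (by nlinarith [norm_nonneg x]) h6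
      exact h3.trans (h4.trans h5)
    · refine (ContinuousLinearMap.opNorm_le_bound _ (by positivity) (hvnorm x)).trans ?_
      have := norm_nonneg x
      have h6 : 0 ≤ C := by rw [hC]; positivity
      nlinarith [mul_nonneg h6 this]
  -- The tangent inequality is taken at the displaced point `T x`, not at `x`. The slope there,
  -- applied to `DT(x) h(x)`, is the derivative of `u ∘ T` along `h`, whose integral vanishes.
  -- Replacing `Z` by `DT h` costs only `h - Z` and `t DZ h`; no second derivative of `u`, which
  -- could blow up as `δ → 0`, is involved.
  have hpt : ∀ x, ψ (T x) - ψ x ≤ t * fderiv ℝ (u ∘ T) x (h x) +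
      (t * (R * ‖h x - Z x‖ + t * R * D * ‖h x‖) + 2 * (R * δ)) := by
    intro x
    have h1 := huc.fderiv_apply_sub_le (hud (T x)) x
    have h2 : x - T x = -(t • Z x) := by simp [hT]
    rw [h2, map_neg, map_smul, smul_eq_mul] at h1
    have h3 : fderiv ℝ u (T x) (Z x) ≤ fderiv ℝ (u ∘ T) x (h x) +
        (R * ‖h x - Z x‖ + t * R * D * ‖h x‖) := by
      have h4 : Z x = (h x + t • fderiv ℝ Z x (h x)) - ((h x - Z x) + t • fderiv ℝ Z x (h x)) := by
        abel
      rw [hvd]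
      conv_lhs => rw [h4]
      rw [map_sub]
      have h5 := hfu' (T x) ((h x - Z x) + t • fderiv ℝ Z x (h x))
      have h6 : ‖(h x - Z x) + t • fderiv ℝ Z x (h x)‖ ≤ ‖h x - Z x‖ + t * D * ‖h x‖ :=
        (norm_add_le _ _).trans (by gcongr; exact hZw x _)
      have h7 := mul_le_mul_of_nonneg_left h6 hR0
      have h8 := (abs_le.1 h5).1
      linarith
    have h4 := mul_le_mul_of_nonneg_left h3 ht.le
    have h5 := abs_le.1 (huψ (T x))
    have h6 := abs_le.1 (huψ x)
    linarith
  have hi1 : Integrable (fun x => fderiv ℝ (u ∘ T) x (h x)) m.1 := by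
    refine Integrable.mono' (hhi.norm.const_mul (R * (1 + t * D))) ?_ (.of_forall fun x => hvnorm x _)
    exact aestronglyMeasurable_clm_apply
      ((hu.comp hTc).continuous_fderiv (by simp)).aestronglyMeasurable hh.aestronglyMeasurable
  have hi2 : Integrable (fun x => R * ‖h x - Z x‖) m.1 := (hhi.sub hZi).norm.const_mul _
  have hi3 : Integrable (fun x => t * R * D * ‖h x‖) m.1 := hhi.norm.const_mul _
  have hi4 : Integrable (fun x => t * (R * ‖h x - Z x‖ + t * R * D * ‖h x‖)) m.1 :=
    (hi2.add hi3).const_mul t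
  have hi5 : Integrable (fun x => t * (R * ‖h x - Z x‖ + t * R * D * ‖h x‖) + 2 * (R * δ)) m.1 :=
    hi4.add (integrable_const _)
  have hle := integral_mono (integrable_lipschitz_perturbation hl hZ.continuous hZi t)
    ((hi1.const_mul t).add hi5) hpt
  have heq : ∫ x, (t * fderiv ℝ (u ∘ T) x (h x) +
      (t * (R * ‖h x - Z x‖ + t * R * D * ‖h x‖) + 2 * (R * δ))) ∂m.1 =
      t * (R * ∫ x, ‖h x - Z x‖ ∂m.1 + t * R * D * ∫ x, ‖h x‖ ∂m.1) + 2 * (R * δ) := by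
    rw [integral_add (hi1.const_mul t) hi5, integral_const_mul, hzero,
      integral_add hi4 (integrable_const _), integral_const_mul, integral_add hi2 hi3,
      integral_const_mul, integral_const_mul]
    simp
  refine (hle.trans_eq heq).trans ?_
  have h9 : 2 * (R * δ) ≤ ε := by
    rw [hδ]
    field_simp
    linarith
  linarith

theorem le_of_forall_pos_le_add_mul {a b c : ℝ} (h : ∀ t, 0 < t → a ≤ b + t * c) : a ≤ b := by
  have h1 : Tendsto (fun t : ℝ => b + t * c) (𝓝[>] 0) (𝓝 (b + 0 * c)) :=
    ((continuous_const.add (continuous_id.mul continuous_const)).tendsto 0).mono_left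
      nhdsWithin_le_nhds
  rw [zero_mul, add_zero] at h1
  exact ge_of_tendsto h1 (eventually_nhdsWithin_of_forall h)

/-- On support points with `‖y‖ ≤ R` the potential gives `t⟨y, Z⟩ ≤ ψ(x + tZ) - ψ(x)`. Elsewhere
both sides are at most `t‖y‖‖Z‖` in absolute value, since `ψ` is `R`-Lipschitz and `R < ‖y‖`; hence
the factor `2`. Divide by `t` and let `t → 0`. -/
theorem integral_inner_snd_le (hγ : γ ∈ optPlans m ν) {h : M d → M d} (hh : MemLp h 2 m.1)
    (horth : ∀ φ : TestFn d, ∫ x, fderiv ℝ φ.1 x (h x) ∂m.1 = 0) (R : NNReal)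
    {Z : M d → M d} (hZ : ContDiff ℝ ∞ Z) (hZs : HasCompactSupport Z) :
    ∫ p, ⟪p.2, Z p.1⟫ ∂γ ≤ R * ∫ x, ‖h x - Z x‖ ∂m.1 +
      2 * ∫ p in {p | (R : ℝ) < ‖p.2‖}, ‖p.2‖ * ‖Z p.1‖ ∂γ := by
  have hZL : MemLp Z 2 m.1 := hZ.continuous.memLp_of_hasCompactSupport hZs
  obtain ⟨D, hD⟩ : ∃ D, ∀ x, ‖fderiv ℝ Z x‖ ≤ D :=
    (hZs.fderiv (𝕜 := ℝ)).exists_bound_of_continuous (hZ.continuous_fderiv (by simp))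
  set S : Set (M d × M d) := {p | (R : ℝ) < ‖p.2‖} with hS
  have hSm : MeasurableSet S := (isOpen_lt continuous_const (by fun_prop)).measurableSet
  obtain ⟨ψ, hψc, hψl, hψs⟩ := exists_convex_potential {p | p ∈ γ.support ∧ ‖p.2‖ ≤ R} R
    (fun p hp => hp.2)
    (fun n σ z hz => permGain_nonpos_of_mem_support hγ σ z fun i => (hz i).1)
  have hZγ : MemLp (fun p : M d × M d => Z p.1) 2 γ := memLp_comp_fst hγ.1 hZL
  have hi : Integrable (fun p : M d × M d => ‖p.2‖ * ‖Z p.1‖) γ :=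
    integrable_norm_mul_norm (memLp_snd hγ.1) hZγ
  have hi1 : Integrable (fun p : M d × M d => ⟪p.2, Z p.1⟫) γ :=
    integrable_inner_of_memLp (memLp_snd hγ.1) hZγ
  refine le_of_forall_pos_le_add_mul (c := R * D * ∫ x, ‖h x‖ ∂m.1) fun t ht => ?_
  have hψi := integrable_lipschitz_perturbation (μ := m.1) hψl hZ.continuous
    (hZL.integrable one_le_two) t
  have hψi' : Integrable (fun p : M d × M d => ψ (p.1 + t • Z p.1) - ψ p.1) γ :=
    (measurePreserving_fst_of_mem_plans hγ.1).integrable_comp_of_integrable hψi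
  have hpt : ∀ᵐ p ∂γ, t * ⟪p.2, Z p.1⟫ ≤ (ψ (p.1 + t • Z p.1) - ψ p.1) +
      2 * t * S.indicator (fun p : M d × M d => ‖p.2‖ * ‖Z p.1‖) p := by
    filter_upwards [Measure.support_mem_ae (μ := γ)] with p hp
    by_cases hpS : p ∈ S
    · rw [indicator_of_mem hpS]
      have h1 := mul_le_mul_of_nonneg_left (real_inner_le_norm p.2 (Z p.1)) ht.le
      have h2 := (abs_le.1 (hψl.abs_sub_le (p.1 + t • Z p.1) p.1)).1
      rw [add_sub_cancel_left, norm_smul, Real.norm_of_nonneg ht.le] at h2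
      have h3 : (R : ℝ) * (t * ‖Z p.1‖) ≤ ‖p.2‖ * (t * ‖Z p.1‖) :=
        mul_le_mul_of_nonneg_right (le_of_lt hpS) (by positivity)
      linarith
    · rw [indicator_of_notMem hpS, mul_zero, add_zero]
      have h1 := hψs p ⟨hp, not_lt.1 hpS⟩ (p.1 + t • Z p.1)
      rw [add_sub_cancel_left, inner_smul_right] at h1
      linarith
  have hle := integral_mono_ae (hi1.const_mul t)
    (hψi'.add ((hi.indicator hSm).const_mul (2 * t))) hpt
  have heq : ∫ p, ((ψ (p.1 + t • Z p.1) - ψ p.1) +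
      2 * t * S.indicator (fun p : M d × M d => ‖p.2‖ * ‖Z p.1‖) p) ∂γ =
      ∫ x, (ψ (x + t • Z x) - ψ x) ∂m.1 + 2 * t * ∫ p in S, ‖p.2‖ * ‖Z p.1‖ ∂γ := by
    rw [integral_add hψi' ((hi.indicator hSm).const_mul (2 * t)), integral_const_mul,
      integral_indicator hSm, ← integral_comp_fst hγ.1 hψi.aestronglyMeasurable]
  rw [integral_const_mul] at hle
  have h2 := (hle.trans_eq heq).trans (add_le_add_left
    (integral_convex_perturbation_le hh horth hψc hψl hZ hZs hD ht) _)
  refine le_of_mul_le_mul_left (h2.trans_eq ?_) ht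
  ring

/-- For fixed `R` the smooth field `Z` tends to `h` in `L²(m)`; only then does `R → ∞` remove the
tail. -/
theorem integral_inner_snd_nonpos (hγ : γ ∈ optPlans m ν) {h : M d → M d} (hh : MemLp h 2 m.1)
    (horth : ∀ φ : TestFn d, ∫ x, fderiv ℝ φ.1 x (h x) ∂m.1 = 0) :
    ∫ p, ⟪p.2, h p.1⟫ ∂γ ≤ 0 := by
  have hprob := isProbabilityMeasure_of_mem_plans hγ.1
  have hy := memLp_snd hγ.1
  set Y := lpNorm (fun p : M d × M d => p.2) 2 γ with hY
  have hY0 : 0 ≤ Y := lpNorm_nonneg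
  have hhγ : MemLp (fun p : M d × M d => h p.1) 2 γ := memLp_comp_fst hγ.1 hh
  have hi : Integrable (fun p : M d × M d => ‖p.2‖ * ‖h p.1‖) γ := integrable_norm_mul_norm hy hhγ
  have key : ∀ R : NNReal, ∫ p, ⟪p.2, h p.1⟫ ∂γ ≤
      2 * ∫ p in {p | (R : ℝ) < ‖p.2‖}, ‖p.2‖ * ‖h p.1‖ ∂γ := by
    intro R
    -- `R` comes from `‖h - Z‖`, one `Y` from replacing `h` by `Z` on the left, and two from doing
    -- so in the doubled tail.
    refine le_of_forall_pos_le_add_mul (c := R + 3 * Y) fun ε hε => ?_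
    obtain ⟨Z, hZs, hZ, hZε⟩ := hh.exist_eLpNorm_sub_le ENNReal.ofNat_ne_top one_le_two hε
    have hZL : MemLp Z 2 m.1 := hZ.continuous.memLp_of_hasCompactSupport hZs
    have hsub : MemLp (fun x => h x - Z x) 2 m.1 := hh.sub hZL
    have hsubγ : MemLp (fun p : M d × M d => h p.1 - Z p.1) 2 γ := memLp_comp_fst hγ.1 hsub
    have hn : lpNorm (fun x => h x - Z x) 2 m.1 ≤ ε := by
      rw [← toReal_eLpNorm hsub.aestronglyMeasurable]
      exact ENNReal.toReal_le_of_le_ofReal hε.le hZε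
    have h1 := integral_inner_snd_le hγ hh horth R hZ hZs
    have h2 : ∫ x, ‖h x - Z x‖ ∂m.1 ≤ ε := (integral_norm_le_lpNorm hsub).trans hn
    have hnγ : lpNorm (fun p : M d × M d => h p.1 - Z p.1) 2 γ ≤ ε := by
      refine (sq_le_sq₀ lpNorm_nonneg hε.le).1 ?_
      rw [lpNorm_two_sq hsubγ,
        integral_comp_fst hγ.1 (f := fun x => ‖h x - Z x‖ ^ 2)
          (hsub.aestronglyMeasurable.norm.pow 2), ← lpNorm_two_sq hsub]
      exact pow_le_pow_left₀ lpNorm_nonneg hn 2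
    have h3 : ∫ p, ‖p.2‖ * ‖h p.1 - Z p.1‖ ∂γ ≤ Y * ε :=
      (integral_norm_mul_norm_le hy hsubγ).trans (mul_le_mul_of_nonneg_left hnγ hY0)
    have hi3 : Integrable (fun p : M d × M d => ‖p.2‖ * ‖h p.1 - Z p.1‖) γ :=
      integrable_norm_mul_norm hy hsubγ
    have hZγ : MemLp (fun p : M d × M d => Z p.1) 2 γ := memLp_comp_fst hγ.1 hZL
    have h4 : ∫ p, ⟪p.2, h p.1⟫ ∂γ ≤ ∫ p, ⟪p.2, Z p.1⟫ ∂γ + Y * ε := by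
      have h5 : ∫ p, ⟪p.2, h p.1⟫ ∂γ = ∫ p, ⟪p.2, Z p.1⟫ ∂γ + ∫ p, ⟪p.2, h p.1 - Z p.1⟫ ∂γ := by
        rw [← integral_add (integrable_inner_of_memLp hy hZγ) (integrable_inner_of_memLp hy hsubγ)]
        simp only [inner_sub_right, add_sub_cancel]
      have h6 := integral_mono (integrable_inner_of_memLp hy hsubγ) hi3
        (fun p => real_inner_le_norm p.2 (h p.1 - Z p.1))
      linarith
    set S : Set (M d × M d) := {p | (R : ℝ) < ‖p.2‖} with hS
    have h7 : ∫ p in S, ‖p.2‖ * ‖Z p.1‖ ∂γ ≤ ∫ p in S, ‖p.2‖ * ‖h p.1‖ ∂γ + Y * ε := by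
      have h8 : ∫ p in S, ‖p.2‖ * ‖Z p.1‖ ∂γ ≤
          ∫ p in S, (‖p.2‖ * ‖h p.1‖ + ‖p.2‖ * ‖h p.1 - Z p.1‖) ∂γ := by
        refine integral_mono (integrable_norm_mul_norm hy hZγ).integrableOn
          (hi.add hi3).integrableOn fun p => ?_
        dsimp only
        rw [← mul_add]
        refine mul_le_mul_of_nonneg_left ?_ (norm_nonneg _)
        have h8 := norm_sub_le (h p.1) (h p.1 - Z p.1)
        rwa [sub_sub_cancel] at h8
      rw [integral_add hi.integrableOn hi3.integrableOn] at h8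
      have h9 : ∫ p in S, ‖p.2‖ * ‖h p.1 - Z p.1‖ ∂γ ≤ ∫ p, ‖p.2‖ * ‖h p.1 - Z p.1‖ ∂γ :=
        setIntegral_le_integral hi3 (.of_forall fun _ => by positivity)
      linarith
    have h10 := mul_le_mul_of_nonneg_left h2 R.coe_nonneg
    linarith
  have hlim : Tendsto (fun n : ℕ => ∫ p in {p | (n : ℝ) < ‖p.2‖}, ‖p.2‖ * ‖h p.1‖ ∂γ) atTop
      (𝓝 0) := by
    have h1 := tendsto_setIntegral_of_antitone (μ := γ)
      (s := fun n : ℕ => {p : M d × M d | (n : ℝ) < ‖p.2‖}) (f := fun p => ‖p.2‖ * ‖h p.1‖)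
      (fun n => (isOpen_lt continuous_const (by fun_prop)).measurableSet)
      (fun a b hab p (hp : (b : ℝ) < ‖p.2‖) =>
        show (a : ℝ) < ‖p.2‖ from lt_of_le_of_lt (Nat.cast_le.2 hab) hp) ⟨0, hi.integrableOn⟩
    have h2 : ⋂ n : ℕ, {p : M d × M d | (n : ℝ) < ‖p.2‖} = ∅ := by
      ext p
      simp only [mem_iInter, mem_empty_iff_false, iff_false, not_forall]
      obtain ⟨n, hn⟩ := exists_nat_ge ‖p.2‖
      exact ⟨n, not_lt.2 hn⟩
    rwa [h2, setIntegral_empty] at h1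
  have hlim2 := hlim.const_mul 2
  rw [mul_zero] at hlim2
  exact ge_of_tendsto' hlim2 fun n => by simpa using key n

/-- A vector field orthogonal to gradients is orthogonal to the displacement of optimal plans. -/
theorem integral_inner_displacement_eq_zero (hγ : γ ∈ optPlans m ν) {h : M d → M d}
    (hh : MemLp h 2 m.1) (horth : ∀ φ : TestFn d, ∫ x, fderiv ℝ φ.1 x (h x) ∂m.1 = 0) :
    ∫ p, ⟪h p.1, p.2 - p.1⟫ ∂γ = 0 := by
  have hhγ : MemLp (fun p : M d × M d => h p.1) 2 γ := memLp_comp_fst hγ.1 hh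
  have h1 := integral_inner_snd_nonpos hγ hh horth
  -- The hypothesis is symmetric under `h ↦ -h`, which turns the inequality into an equality.
  have h2 := integral_inner_snd_nonpos hγ (h := fun x => -h x) hh.neg
    (fun φ => by simp only [map_neg, integral_neg, horth, neg_zero])
  simp only [inner_neg_right, integral_neg] at h2
  have h3 : ∫ p, ⟪h p.1, p.2⟫ ∂γ = 0 := by
    simp_rw [real_inner_comm]
    linarith
  have h4 : ∫ p, ⟪h p.1, p.1⟫ ∂γ = 0 := by
    rw [integral_comp_fst hγ.1 (f := fun x => ⟪h x, x⟫)
      (hh.aestronglyMeasurable.inner m.2.2.aestronglyMeasurable)]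
    exact integral_inner_id_eq_zero hh horth
  simp_rw [inner_sub_right]
  rw [integral_sub (integrable_inner_of_memLp hhγ (memLp_snd hγ.1))
    (integrable_inner_of_memLp hhγ (memLp_fst hγ.1)), h3, h4, sub_zero]

/-! ### Optimal transport by small gradient perturbations -/

theorem norm_sub_sub_fderiv_le {E F : Type*} [NormedAddCommGroup E] [NormedSpace ℝ E]
    [NormedAddCommGroup F] [NormedSpace ℝ F] {f : E → F} (hf : Differentiable ℝ f) {L : NNReal}
    (hL : LipschitzWith L (fderiv ℝ f)) (x y : E) :
    ‖f y - f x - fderiv ℝ f x (y - x)‖ ≤ L * ‖y - x‖ ^ 2 := by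
  rw [pow_two, ← mul_assoc]
  refine Convex.norm_image_sub_le_of_norm_fderiv_le' (s := segment ℝ x y) (fun z _ => hf z)
    (fun z hz => ?_) (convex_segment x y) (left_mem_segment ℝ x y) (right_mem_segment ℝ x y)
  refine (hL.norm_sub_le z x).trans ?_
  gcongr
  rw [← dist_eq_norm, ← dist_eq_norm, dist_comm, dist_comm y]
  have := dist_add_dist_of_mem_segment hz
  linarith [dist_nonneg (x := z) (y := y)]

theorem exists_lipschitz_fderiv {E F : Type*} [NormedAddCommGroup E] [NormedSpace ℝ E]
    [NormedAddCommGroup F] [NormedSpace ℝ F] {f : E → F} (hf : ContDiff ℝ ∞ f)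
    (hs : HasCompactSupport f) : ∃ L : NNReal, LipschitzWith L (fderiv ℝ f) :=
  ContDiff.lipschitzWith_of_hasCompactSupport (hs.fderiv (𝕜 := ℝ))
    (hf.fderiv_right (m := ∞) (by simp)) (by simp)

theorem lipschitzWith_gradient {f : M d → ℝ} {L : NNReal} (hL : LipschitzWith L (fderiv ℝ f)) :
    LipschitzWith L (∇ f) := by
  have h := (InnerProductSpace.toDual ℝ (M d)).symm.lipschitz.comp hL
  rwa [one_mul] at h

/-- The image of `m` under a measurable map that is square integrable. -/
noncomputable def push (m : P2 d) (T : M d → M d) (hT : Measurable T) (hT2 : MemLp T 2 m.1) :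
    P2 d :=
  ⟨m.1.map T, Measure.isProbabilityMeasure_map hT.aemeasurable,
    (memLp_map_measure_iff aestronglyMeasurable_id hT.aemeasurable).2 hT2⟩

/-- Small perturbations of the identity by gradients are the unique optimal transports. -/
theorem exists_unique_transport (m : P2 d) (φ : TestFn d) :
    ∃ t₀ : ℝ, 0 < t₀ ∧ ∀ t : ℝ, 0 < t → t < t₀ → ∃ ν : P2 d,
      W2 m ν ≤ t * ‖gradL2 m φ‖ ∧
      ∀ γ ∈ optPlans m ν, ∀ᵐ p ∂γ, p.2 = p.1 + t • ∇ φ.1 p.1 := by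
  obtain ⟨L, hL⟩ := exists_lipschitz_fderiv φ.2.1 φ.2.2
  have hgL := lipschitzWith_gradient hL
  have hgc : Continuous (∇ φ.1) := (contDiff_gradient φ).continuous
  have hg2 : MemLp (∇ φ.1) 2 m.1 := memLp_gradient φ m
  have hnorm : ‖gradL2 m φ‖ ^ 2 = ∫ x, ‖∇ φ.1 x‖ ^ 2 ∂m.1 := by
    rw [gradL2, Lp.norm_toLp, toReal_eLpNorm hg2.aestronglyMeasurable, lpNorm_two_sq hg2]
  -- This gives `2tL < 1`: the map `id + t∇φ` is then a homeomorphism, and the coefficient `1 - 2tL`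
  -- in the cost estimate below is positive.
  refine ⟨(2 * L + 1 : ℝ)⁻¹, by positivity, fun t ht htL => ?_⟩
  have htL1 : t * (2 * L + 1) < 1 := by
    rwa [lt_inv_comm₀ ht (by positivity), ← one_div, lt_div_iff₀ ht, mul_comm] at htL
  have htL2 : 2 * (t * L) < 1 := by nlinarith
  set T : M d → M d := fun x => x + t • ∇ φ.1 x with hT
  have hTc : Continuous T := by simp only [hT]; fun_prop
  have hT2 : MemLp T 2 m.1 := m.2.2.add (hg2.const_smul t)
  set ν := push m T hTc.measurable hT2 with hν
  have hplan : m.1.map (fun x => (x, T x)) ∈ plans m ν := by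
    constructor
    · rw [Measure.map_map (by fun_prop) (by fun_prop)]; exact Measure.map_id
    · rw [Measure.map_map (by fun_prop) (by fun_prop)]; rfl
  have hcostT : cost (m.1.map (fun x => (x, T x))) = t ^ 2 * ‖gradL2 m φ‖ ^ 2 := by
    rw [cost, integral_map (by fun_prop) (by fun_prop), hnorm, ← integral_const_mul]
    refine integral_congr_ae (.of_forall fun x => ?_)
    simp only [hT, sub_add_cancel_left, norm_neg, norm_smul, mul_pow, Real.norm_eq_abs, sq_abs]
  have hW : W2 m ν ^ 2 ≤ t ^ 2 * ‖gradL2 m φ‖ ^ 2 := hcostT ▸ W2_sq_le_cost hplan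
  refine ⟨ν, ?_, fun γ hγ => ?_⟩
  · rw [← mul_pow] at hW
    exact (sq_le_sq₀ (W2_nonneg _ _) (by positivity)).1 hW
  have happ : ApproximatesLinearOn T
      ((ContinuousLinearEquiv.refl ℝ (M d) : M d ≃L[ℝ] M d) : M d →L[ℝ] M d) univ
      (Real.toNNReal t * L) := by
    intro x _ y _
    have h1 : T x - T y - (x - y) = t • (∇ φ.1 x - ∇ φ.1 y) := by
      simp only [hT, smul_sub]; abel
    have h2 := hgL.norm_sub_le x y
    simp only [ContinuousLinearEquiv.coe_coe, ContinuousLinearEquiv.refl_apply, h1, norm_smul,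
      Real.norm_of_nonneg ht.le, NNReal.coe_mul, Real.coe_toNNReal t ht.le, mul_assoc]
    exact mul_le_mul_of_nonneg_left h2 ht.le
  -- For `d = 0` the identity has norm `0` and the strict inequality fails, hence the alternative.
  have hsmall : Subsingleton (M d) ∨ Real.toNNReal t * L <
      ‖((ContinuousLinearEquiv.refl ℝ (M d)).symm : M d →L[ℝ] M d)‖₊⁻¹ := by
    rcases subsingleton_or_nontrivial (M d) with h | h
    · exact .inl h
    · right
      have h1 : ‖((ContinuousLinearEquiv.refl ℝ (M d)).symm : M d →L[ℝ] M d)‖₊ = 1 := by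
        rw [ContinuousLinearEquiv.refl_symm, ContinuousLinearEquiv.coe_refl]
        exact ContinuousLinearMap.nnnorm_id
      rw [h1, inv_one, ← NNReal.coe_lt_coe, NNReal.coe_mul, Real.coe_toNNReal t ht.le,
        NNReal.coe_one]
      nlinarith [mul_nonneg ht.le L.coe_nonneg]
  set e : M d ≃ₜ M d := happ.toHomeomorph T hsmall with he
  have heT : ∀ x, e x = T x := fun x => rfl
  set S : M d → M d := fun y => e.symm y with hS
  have hSc : Continuous S := e.symm.continuous
  have hTS : ∀ y, T (S y) = y := fun y => by rw [← heT]; exact e.apply_symm_apply y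
  have hST : ∀ x, S (T x) = x := fun x => by rw [← heT]; exact e.symm_apply_apply x
  have hSν : ν.1.map S = m.1 := by
    change (m.1.map T).map S = m.1
    rw [Measure.map_map hSc.measurable hTc.measurable]
    have : S ∘ T = id := funext hST
    rw [this, Measure.map_id]
  have hSp : MeasurePreserving (fun p : M d × M d => S p.2) γ m.1 :=
    (⟨hSc.measurable, hSν⟩ : MeasurePreserving S ν.1 m.1).comp
      (measurePreserving_snd_of_mem_plans hγ.1)
  have hSL : MemLp (fun p : M d × M d => S p.2) 2 γ := m.2.2.comp_measurePreserving hSp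
  have hφc : Continuous φ.1 := φ.2.1.continuous
  have hφi : Integrable φ.1 m.1 := hφc.integrable_of_hasCompactSupport φ.2.2
  have hφ1 : Integrable (fun p : M d × M d => φ.1 p.1) γ :=
    (measurePreserving_fst_of_mem_plans hγ.1).integrable_comp_of_integrable hφi
  have hφ2 : Integrable (fun p : M d × M d => φ.1 (S p.2)) γ :=
    hSp.integrable_comp_of_integrable hφi
  have hφ12 : ∫ p, φ.1 (S p.2) ∂γ = ∫ p, φ.1 p.1 ∂γ := by
    rw [integral_comp_fst hγ.1 hφc.aestronglyMeasurable, ← hSp.map_eq,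
      integral_map hSp.measurable.aemeasurable hφc.aestronglyMeasurable]
  have hgi : Integrable (fun x => ‖∇ φ.1 x‖ ^ 2) m.1 := hg2.integrable_norm_pow (by norm_num)
  have hg' : Integrable (fun p : M d × M d => ‖∇ φ.1 (S p.2)‖ ^ 2) γ :=
    hSp.integrable_comp_of_integrable hgi
  have hg'' : ∫ p, ‖∇ φ.1 (S p.2)‖ ^ 2 ∂γ = ‖gradL2 m φ‖ ^ 2 := by
    rw [hnorm]
    conv_rhs => rw [← hSp.map_eq]
    rw [integral_map hSp.measurable.aemeasurable (by fun_prop)]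
  have hdi : Integrable (fun p : M d × M d => ‖p.1 - S p.2‖ ^ 2) γ :=
    ((memLp_fst hγ.1).sub hSL).integrable_norm_pow (by norm_num)
  -- Write `y = s + t∇φ(s)` with `s = S y`, expand the square and bound `⟨∇φ(s), x - s⟩` by Taylor's
  -- formula. Since `x` and `s` both have law `m` under `γ`, the terms in `φ` cancel on integration.
  -- What is left is the cost of the map plus a positive multiple of `∫ ‖x - s‖²`, which optimality
  -- forces to vanish.
  have hpt : ∀ p : M d × M d, (1 - 2 * (t * L)) * ‖p.1 - S p.2‖ ^ 2 +
      (2 * t * (φ.1 (S p.2) - φ.1 p.1) + t ^ 2 * ‖∇ φ.1 (S p.2)‖ ^ 2) ≤ ‖p.1 - p.2‖ ^ 2 := by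
    intro p
    have h1 : p.1 - p.2 = (p.1 - S p.2) - t • ∇ φ.1 (S p.2) := by
      conv_lhs => rw [← hTS p.2]
      simp only [hT]; abel
    have h2 := (abs_le.1 ((Real.norm_eq_abs _).symm.trans_le
      (norm_sub_sub_fderiv_le (φ.2.1.differentiable (by simp)) hL (S p.2) p.1))).1
    rw [← inner_gradient_eq_fderiv, real_inner_comm] at h2
    rw [h1, norm_sub_sq_real (p.1 - S p.2), inner_smul_right, norm_smul, mul_pow, Real.norm_eq_abs, sq_abs]
    have h3 := mul_le_mul_of_nonneg_left h2 (by positivity : 0 ≤ 2 * t)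
    linarith
  have hφ3 : Integrable (fun p : M d × M d => 2 * t * (φ.1 (S p.2) - φ.1 p.1)) γ :=
    (hφ2.sub hφ1).const_mul (2 * t)
  have hφ4 : Integrable (fun p : M d × M d =>
      2 * t * (φ.1 (S p.2) - φ.1 p.1) + t ^ 2 * ‖∇ φ.1 (S p.2)‖ ^ 2) γ :=
    hφ3.add (hg'.const_mul (t ^ 2))
  have hle := integral_mono ((hdi.const_mul (1 - 2 * (t * L))).add hφ4) (integrable_cost hγ.1) hpt
  have heq : ∫ p : M d × M d, ((1 - 2 * (t * L)) * ‖p.1 - S p.2‖ ^ 2 +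
      (2 * t * (φ.1 (S p.2) - φ.1 p.1) + t ^ 2 * ‖∇ φ.1 (S p.2)‖ ^ 2)) ∂γ =
      (1 - 2 * (t * L)) * ∫ p, ‖p.1 - S p.2‖ ^ 2 ∂γ + t ^ 2 * ‖gradL2 m φ‖ ^ 2 := by
    rw [integral_add (hdi.const_mul _) hφ4, integral_add hφ3 (hg'.const_mul (t ^ 2)),
      integral_const_mul, integral_const_mul, integral_const_mul, integral_sub hφ2 hφ1, hφ12, hg'']
    ring
  have hcγ : cost γ ≤ t ^ 2 * ‖gradL2 m φ‖ ^ 2 := hγ.2 ▸ hW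
  have h0 : ∫ p, ‖p.1 - S p.2‖ ^ 2 ∂γ = 0 := by
    refine le_antisymm ?_ (integral_nonneg fun _ => by positivity)
    have h1 := (heq.symm.trans_le hle).trans hcγ
    have h2 : (1 - 2 * (t * L)) * ∫ p, ‖p.1 - S p.2‖ ^ 2 ∂γ ≤ (1 - 2 * (t * L)) * 0 := by linarith
    exact le_of_mul_le_mul_left h2 (by linarith)
  filter_upwards [(integral_eq_zero_iff_of_nonneg (fun _ => by positivity) hdi).1 h0] with p hp
  have h1 : p.1 = S p.2 := by
    simpa [sub_eq_zero] using hp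
  conv_lhs => rw [← hTS p.2, ← h1]

/-! ### Strong gradients and the subgradient of minimal norm -/

theorem lpNorm_displacement (hγ : γ ∈ optPlans m ν) :
    lpNorm (fun p : M d × M d => p.2 - p.1) 2 γ = W2 m ν := by
  refine (sq_eq_sq₀ lpNorm_nonneg (W2_nonneg m ν)).1 ?_
  rw [lpNorm_two_sq (memLp_displacement hγ.1), hγ.2, cost]
  simp_rw [norm_sub_rev]

/-- The first order expansion `F[ν] = F[m] + ∫ g(x) · (y - x) dγ + o(W₂(m, ν))`, uniformly in the
optimal plans `γ`. -/
def IsStrongGradient (F : P2 d → ℝ) (m : P2 d) (g : M d → M d) : Prop :=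
  ∀ ε : ℝ, 0 < ε → ∃ δ : ℝ, 0 < δ ∧ ∀ ν : P2 d, W2 m ν < δ → ∀ γ ∈ optPlans m ν,
    |F ν - F m - ∫ p, ⟪g p.1, p.2 - p.1⟫ ∂γ| ≤ ε * W2 m ν

theorem integral_inner_displacement_congr (h : γ ∈ plans m ν) {g g' : M d → M d}
    (hg : g =ᵐ[m.1] g') :
    ∫ p, ⟪g p.1, p.2 - p.1⟫ ∂γ = ∫ p, ⟪g' p.1, p.2 - p.1⟫ ∂γ := by
  refine integral_congr_ae ?_
  filter_upwards [(measurePreserving_fst_of_mem_plans h).quasiMeasurePreserving.ae hg] with p hp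
  rw [hp]

theorem IsStrongGradient.congr {F : P2 d → ℝ} {g g' : M d → M d} (hF : IsStrongGradient F m g)
    (hg : g =ᵐ[m.1] g') : IsStrongGradient F m g' := by
  intro ε hε
  obtain ⟨δ, hδ, h⟩ := hF ε hε
  refine ⟨δ, hδ, fun ν hν γ hγ => ?_⟩
  rw [← integral_inner_displacement_congr hγ.1 hg]
  exact h ν hν γ hγ

theorem IsStrongGradient.neg {F : P2 d → ℝ} {g : M d → M d} (hF : IsStrongGradient F m g) :
    IsStrongGradient (fun ν => -F ν) m (fun x => -g x) := by
  intro ε hε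
  obtain ⟨δ, hδ, h⟩ := hF ε hε
  refine ⟨δ, hδ, fun ν hν γ hγ => ?_⟩
  simp only [inner_neg_left, integral_neg]
  rw [← abs_neg]
  convert h ν hν γ hγ using 2
  ring

theorem IsStrongGradient.mem_subdiff {F : P2 d → ℝ} {G : L2 m} (hF : IsStrongGradient F m G) :
    G ∈ subdiff (fun ν => (F ν : EReal)) m := by
  intro ε hε
  obtain ⟨δ, hδ, h⟩ := hF ε hε
  refine ⟨δ, hδ, fun ν hν => ?_⟩
  obtain ⟨γ, hγ⟩ := optPlans_nonempty m ν
  -- A real `sInf` is below its elements only for a set bounded below; Cauchy-Schwarz provides the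
  -- bound `-‖G‖ W₂`.
  have hb : BddBelow ((fun γ : Measure (M d × M d) => ∫ p, ⟪G p.1, p.2 - p.1⟫ ∂γ) ''
      optPlans m ν) := by
    refine ⟨-(lpNorm G 2 m.1 * W2 m ν), ?_⟩
    rintro _ ⟨γ', hγ', rfl⟩
    have hG : MemLp (fun p : M d × M d => G p.1) 2 γ' := memLp_comp_fst hγ'.1 (Lp.memLp G)
    have h1 := (abs_le.1 (abs_integral_inner_le hG (memLp_displacement hγ'.1))).1
    have h2 : lpNorm (fun p : M d × M d => G p.1) 2 γ' = lpNorm G 2 m.1 := by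
      rw [← toReal_eLpNorm hG.aestronglyMeasurable,
        ← toReal_eLpNorm (Lp.aestronglyMeasurable G),
        ← eLpNorm_comp_measurePreserving (Lp.aestronglyMeasurable G)
          (measurePreserving_fst_of_mem_plans hγ'.1)]
      rfl
    rwa [lpNorm_displacement hγ', h2] at h1
  have h1 := csInf_le hb ⟨γ, hγ, rfl⟩
  have h2 := (abs_le.1 (h ν hν γ hγ)).1
  refine EReal.coe_le_coe_iff.2 ?_
  rw [EReal.toReal_coe]
  dsimp only at h1
  linarith

theorem IsStrongGradient.mem_superdiff {F : P2 d → ℝ} {G : L2 m} (hF : IsStrongGradient F m G) :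
    G ∈ superdiff (fun ν => (F ν : EReal)) m := by
  have h := (hF.neg.congr (Lp.coeFn_neg G).symm).mem_subdiff
  change -G ∈ subdiff (fun ν => -(F ν : EReal)) m
  simpa only [EReal.coe_neg] using h

theorem gradient_neg' (φ : M d → ℝ) (x : M d) : ∇ (fun y => -φ y) x = -∇ φ x := by
  simp only [gradient, fderiv_fun_neg, map_neg]

/-- Test the subgradient inequality at the image of `m` under `id + t∇φ`. Every optimal plan gives
the pairing the same value `t ∫ ⟨ξ, ∇φ⟩`, so the infimum disappears; the expansion bounds the
increment from above, and division by `t` leaves an error `2Nε`. -/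
theorem integral_inner_gradient_le {F : P2 d → ℝ} {g : M d → M d} (hF : IsStrongGradient F m g)
    (hg : AEStronglyMeasurable g m.1)
    {ξ : L2 m} (hξ : ξ ∈ subdiff (fun ν => (F ν : EReal)) m) (φ : TestFn d) :
    ∫ x, ⟪ξ x, ∇ φ.1 x⟫ ∂m.1 ≤ ∫ x, ⟪g x, ∇ φ.1 x⟫ ∂m.1 := by
  set N := ‖gradL2 m φ‖ with hN
  have hN0 : 0 ≤ N := norm_nonneg _
  have hgm : AEStronglyMeasurable (∇ φ.1) m.1 :=
    (contDiff_gradient φ).continuous.aestronglyMeasurable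
  refine le_of_forall_pos_le_add_mul (c := 2 * N) fun ε hε => ?_
  obtain ⟨δ₁, hδ₁, h1⟩ := hξ ε hε
  obtain ⟨δ₂, hδ₂, h2⟩ := hF ε hε
  obtain ⟨t₀, ht₀, htr⟩ := exists_unique_transport m φ
  -- Dividing by `N + 1` rather than `N` covers the case of a gradient vanishing in `L²(m)`.
  obtain ⟨t, ht, htlt⟩ := exists_between (lt_min ht₀
    (div_pos (lt_min hδ₁ hδ₂) (by linarith : 0 < N + 1)))
  obtain ⟨ν, hW, hν⟩ := htr t ht (htlt.trans_le (min_le_left _ _))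
  have htN : t * N < min δ₁ δ₂ := by
    have := (lt_div_iff₀ (by linarith : 0 < N + 1)).1 (htlt.trans_le (min_le_right _ _))
    linarith
  have hWδ := hW.trans_lt htN
  have hint : ∀ f : M d → M d, AEStronglyMeasurable f m.1 → ∀ γ ∈ optPlans m ν,
      ∫ p, ⟪f p.1, p.2 - p.1⟫ ∂γ = t * ∫ x, ⟪f x, ∇ φ.1 x⟫ ∂m.1 := by
    intro f hf γ hγ
    rw [← integral_comp_fst hγ.1 (hf.inner hgm), ← integral_const_mul]
    refine integral_congr_ae ?_
    filter_upwards [hν γ hγ] with p hp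
    rw [hp, add_sub_cancel_left, inner_smul_right]
  obtain ⟨γ, hγ⟩ := optPlans_nonempty m ν
  have himg : (fun γ : Measure (M d × M d) => ∫ p, ⟪ξ p.1, p.2 - p.1⟫ ∂γ) '' optPlans m ν =
      {t * ∫ x, ⟪ξ x, ∇ φ.1 x⟫ ∂m.1} := by
    refine Set.eq_singleton_iff_unique_mem.2
      ⟨⟨γ, hγ, hint ξ (Lp.aestronglyMeasurable ξ) γ hγ⟩, ?_⟩
    rintro _ ⟨γ', hγ', rfl⟩
    exact hint ξ (Lp.aestronglyMeasurable ξ) γ' hγ'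
  have h3 := EReal.coe_le_coe_iff.1 (h1 ν (hWδ.trans_le (min_le_left _ _)))
  rw [himg, csInf_singleton, EReal.toReal_coe] at h3
  have h4 := (abs_le.1 (h2 ν (hWδ.trans_le (min_le_right _ _)) γ hγ)).2
  rw [hint g hg γ hγ] at h4
  have h5 := mul_le_mul_of_nonneg_left hW hε.le
  refine le_of_mul_le_mul_left ?_ ht
  linarith

theorem integral_inner_gradient_eq {F : P2 d → ℝ} {g : M d → M d} (hF : IsStrongGradient F m g)
    (hg : AEStronglyMeasurable g m.1)
    {ξ : L2 m} (hξ : ξ ∈ subdiff (fun ν => (F ν : EReal)) m) (φ : TestFn d) :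
    ∫ x, ⟪ξ x, ∇ φ.1 x⟫ ∂m.1 = ∫ x, ⟪g x, ∇ φ.1 x⟫ ∂m.1 := by
  refine le_antisymm (integral_inner_gradient_le hF hg hξ φ) ?_
  have h := integral_inner_gradient_le hF hg hξ ⟨fun x => -φ.1 x, φ.2.1.neg, φ.2.2.neg⟩
  simp only [gradient_neg', inner_neg_right, integral_neg] at h
  linarith

theorem inner_gradL2 (u : L2 m) (φ : TestFn d) :
    ⟪u, gradL2 m φ⟫ = ∫ x, ⟪u x, ∇ φ.1 x⟫ ∂m.1 := by
  rw [L2.inner_def]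
  refine integral_congr_ae ?_
  filter_upwards [(memLp_gradient φ m).coeFn_toLp] with x hx
  rw [gradL2, hx]

theorem mem_orthogonal_tangent {u : L2 m} (hu : ∀ φ, ⟪u, gradL2 m φ⟫ = 0) :
    u ∈ (tangent m)ᗮ := by
  rw [tangent, Submodule.orthogonal_closure, Submodule.mem_orthogonal']
  intro w hw
  induction hw using Submodule.span_induction with
  | mem w hw => obtain ⟨φ, rfl⟩ := hw; exact hu φ
  | zero => exact inner_zero_right _
  | add a b _ _ ha hb => rw [inner_add_right, ha, hb, add_zero]
  | smul c a _ ha => rw [inner_smul_right, ha, mul_zero]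

instance (m : P2 d) : CompleteSpace (tangent m) :=
  (Submodule.isClosed_topologicalClosure _).completeSpace_coe

/-- The discarded component is orthogonal to gradients, hence does not see the displacement of any
optimal plan. -/
theorem IsStrongGradient.starProjection {F : P2 d → ℝ} {G : L2 m} (hF : IsStrongGradient F m G) :
    IsStrongGradient F m ((tangent m).starProjection G) := by
  set P := (tangent m).starProjection G with hP
  have horth : G - P ∈ (tangent m)ᗮ := Submodule.sub_starProjection_mem_orthogonal G
  have hφ : ∀ φ : TestFn d, ∫ x, fderiv ℝ φ.1 x ((G - P : L2 m) x) ∂m.1 = 0 := by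
    intro φ
    have h := (Submodule.mem_orthogonal' _ _).1 horth (gradL2 m φ) (gradT m φ).2
    rw [inner_gradL2] at h
    rw [← h]
    refine integral_congr_ae (.of_forall fun x => ?_)
    dsimp only
    rw [real_inner_comm, inner_gradient_eq_fderiv]
  intro ε hε
  obtain ⟨δ, hδ, h⟩ := hF ε hε
  refine ⟨δ, hδ, fun ν hν γ hγ => ?_⟩
  have h0 := integral_inner_displacement_eq_zero hγ (Lp.memLp (G - P)) hφ
  rw [integral_inner_displacement_congr hγ.1 (Lp.coeFn_sub G P)] at h0
  simp only [Pi.sub_apply, inner_sub_left] at h0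
  rw [integral_sub (integrable_inner_of_memLp (memLp_comp_fst hγ.1 (Lp.memLp G))
    (memLp_displacement hγ.1)) (integrable_inner_of_memLp (memLp_comp_fst hγ.1 (Lp.memLp P))
    (memLp_displacement hγ.1)), sub_eq_zero] at h0
  rw [← h0]
  exact h ν hν γ hγ

/-- Every subgradient pairs with gradients as `G` does, so it has the same projection onto the
tangent space, and projecting does not increase the norm. -/
theorem IsStrongGradient.isMinSubgradient {F : P2 d → ℝ} {G : L2 m}
    (hF : IsStrongGradient F m G) :
    IsMinSubgradient (fun ν => (F ν : EReal)) m ((tangent m).starProjection G) := by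
  refine ⟨hF.starProjection.mem_subdiff, fun ξ hξ => ?_⟩
  have h1 : ξ - G ∈ (tangent m)ᗮ := mem_orthogonal_tangent fun φ => by
    rw [inner_sub_left, inner_gradL2, inner_gradL2, integral_inner_gradient_eq hF (Lp.aestronglyMeasurable G) hξ, sub_self]
  have h2 : (tangent m).starProjection ξ = (tangent m).starProjection G := by
    rw [← sub_eq_zero, ← map_sub]
    exact (Submodule.starProjection_apply_eq_zero_iff _).2 h1
  rw [← h2]
  exact Submodule.norm_starProjection_apply_le _ ξ

theorem IsStrongGradient.diffAt {F : P2 d → ℝ} {G : L2 m} (hF : IsStrongGradient F m G) :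
    DiffAt (fun ν => (F ν : EReal)) m :=
  ⟨⟨EReal.coe_ne_top _, EReal.coe_ne_bot _⟩, ⟨G, hF.mem_subdiff⟩, ⟨G, hF.mem_superdiff⟩⟩

/-- Existence of a minimal subgradient excludes the default value `0` of `wGrad`. Which minimal
subgradient is chosen is irrelevant, as all subgradients agree on gradients. -/
theorem IsStrongGradient.dirDeriv_gradient {F : P2 d → ℝ} {G : L2 m}
    (hF : IsStrongGradient F m G) (φ : TestFn d) :
    dirDeriv (fun ν => (F ν : EReal)) (∇ φ.1) m = ∫ x, ⟪G x, ∇ φ.1 x⟫ ∂m.1 := by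
  have hex : ∃ ξ : L2 m, IsMinSubgradient (fun ν => (F ν : EReal)) m ξ :=
    ⟨_, hF.isMinSubgradient⟩
  rw [dirDeriv, wGrad, dif_pos hex]
  exact integral_inner_gradient_eq hF (Lp.aestronglyMeasurable G) hex.choose_spec.1 φ

/-! ### Control of the remainders -/

/-- By concavity and `ρ 0 = 0` the quotient `ρ s / s` is nonincreasing, so `ρ` is below a line
beyond any `δ`. The integral of `‖x - y‖ ρ(‖x - y‖)` is then at most `η W₂ + κ W₂²`, with `η`
arbitrarily small. -/
theorem exists_affine_bound {ρ : ℝ → ℝ} (hlim : Tendsto ρ (𝓝[>] 0) (𝓝 0)) (h0 : ρ 0 = 0)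
    (hnonneg : ∀ t, 0 ≤ t → 0 ≤ ρ t) (hc : ConcaveOn ℝ (Ici 0) ρ) {η : ℝ} (hη : 0 < η) :
    ∃ κ : ℝ, 0 ≤ κ ∧ ∀ s, 0 ≤ s → ρ s ≤ η + κ * s := by
  obtain ⟨δ, hδ, hsub⟩ := mem_nhdsGT_iff_exists_Ioc_subset.1
    (hlim.eventually (gt_mem_nhds hη) : {s | ρ s < η} ∈ 𝓝[>] (0 : ℝ))
  have hδ0 : 0 < δ := hδ
  have hκ : 0 ≤ ρ δ / δ := div_nonneg (hnonneg δ hδ0.le) hδ0.le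
  refine ⟨ρ δ / δ, hκ, fun s hs => ?_⟩
  rcases hs.eq_or_lt with rfl | hs0
  · rw [h0]; linarith
  rcases le_or_gt s δ with h | h
  · have h1 : ρ s < η := hsub ⟨hs0, h⟩
    have := mul_nonneg hκ hs
    linarith
  · have ha : 0 ≤ δ / s := by positivity
    have hb : 0 ≤ 1 - δ / s := by rw [sub_nonneg, div_le_one hs0]; exact h.le
    have h1 := hc.2 (mem_Ici.2 hs) (mem_Ici.2 le_rfl) ha hb (by ring)
    simp only [smul_eq_mul, mul_zero, add_zero, h0] at h1
    rw [div_mul_cancel₀ _ hs0.ne', div_mul_eq_mul_div, div_le_iff₀ hs0] at h1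
    have h2 : ρ s ≤ ρ δ / δ * s := by
      rw [div_mul_eq_mul_div, le_div_iff₀ hδ0]; linarith
    linarith

/-- The Taylor remainder of a test field is quadratic even against a field of linear growth. -/
theorem exists_quadratic_bound {ζ : M d → M d} (hζ : ContDiff ℝ ∞ ζ) (hs : HasCompactSupport ζ)
    {a : M d → M d} {C : ℝ} (ha : ∀ x, ‖a x‖ ≤ C * (1 + ‖x‖)) :
    ∃ Q : ℝ, 0 ≤ Q ∧ ∀ x y, ‖a x‖ * ‖ζ y - ζ x - fderiv ℝ ζ x (y - x)‖ ≤ Q * ‖y - x‖ ^ 2 := by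
  have hC : 0 ≤ C := by
    have := (norm_nonneg _).trans (ha 0)
    simpa using this
  obtain ⟨L, hL⟩ := exists_lipschitz_fderiv hζ hs
  obtain ⟨L₁, hL₁⟩ := ContDiff.lipschitzWith_of_hasCompactSupport hs hζ (by simp)
  obtain ⟨R, hR⟩ := hs.isCompact.isBounded.exists_norm_le
  have hR' : ∀ x ∈ tsupport ζ, ‖x‖ ≤ |R| := fun x hx => (hR x hx).trans (le_abs_self R)
  have hR0 : 0 ≤ |R| := abs_nonneg R
  have hd : Differentiable ℝ ζ := hζ.differentiable (by simp)
  refine ⟨C * ((1 + |R|) * L + L₁), by positivity, fun x y => ?_⟩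
  have hrem := norm_sub_sub_fderiv_le hd hL x y
  by_cases hx : x ∈ tsupport ζ
  · calc _ ≤ (C * (1 + |R|)) * (L * ‖y - x‖ ^ 2) := by
          refine mul_le_mul ((ha x).trans ?_) hrem (norm_nonneg _) (by positivity)
          exact mul_le_mul_of_nonneg_left (by linarith [hR' x hx]) hC
      _ ≤ (C * (1 + |R|)) * (L * ‖y - x‖ ^ 2) + C * L₁ * ‖y - x‖ ^ 2 :=
          le_add_of_nonneg_right (by positivity)
      _ = _ := by ring
  -- Off the support the remainder is `ζ y`, and `x` may be far away. If `y` is in the support then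
  -- `‖x‖ ≤ |R| + ‖y - x‖`; the bounded part of the growth uses `‖ζ y‖ ≤ L‖y - x‖²`, the part `‖y -
  -- x‖` uses `‖ζ y‖ ≤ L₁‖y - x‖`.
  · have h1 : ζ x = 0 := image_eq_zero_of_notMem_tsupport hx
    have h2 : fderiv ℝ ζ x = 0 :=
      image_eq_zero_of_notMem_tsupport fun h => hx (tsupport_fderiv_subset ℝ h)
    simp only [h1, h2, sub_zero, zero_apply] at hrem ⊢
    by_cases hy : y ∈ tsupport ζ
    · have h3 : ‖ζ y‖ ≤ L₁ * ‖y - x‖ := by simpa [h1] using hL₁.norm_sub_le y x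
      have h4 : ‖x‖ ≤ |R| + ‖y - x‖ := by
        have := norm_sub_le y (y - x)
        rw [sub_sub_cancel] at this
        linarith [hR' y hy]
      calc ‖a x‖ * ‖ζ y‖ ≤ (C * (1 + (|R| + ‖y - x‖))) * ‖ζ y‖ :=
            mul_le_mul_of_nonneg_right ((ha x).trans
              (mul_le_mul_of_nonneg_left (by linarith) hC)) (norm_nonneg _)
        _ = C * ((1 + |R|) * ‖ζ y‖ + ‖y - x‖ * ‖ζ y‖) := by ring
        _ ≤ C * ((1 + |R|) * (L * ‖y - x‖ ^ 2) + ‖y - x‖ * (L₁ * ‖y - x‖)) := by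
            refine mul_le_mul_of_nonneg_left (add_le_add ?_ ?_) hC
            · exact mul_le_mul_of_nonneg_left hrem (by positivity)
            · exact mul_le_mul_of_nonneg_left h3 (norm_nonneg _)
        _ = _ := by ring
    · rw [image_eq_zero_of_notMem_tsupport hy, norm_zero, mul_zero]
      positivity

/-! ### The gradient of a directional derivative -/

/-- The field `x ↦ ∫ A(z, x)ᵀ ζ(z) m(dz)`. -/
noncomputable def meanAdjoint (m : P2 d) (Amm : M d → M d → M d →L[ℝ] M d) (ζ : M d → M d)
    (x : M d) : M d := ∫ z, ContinuousLinearMap.adjoint (Amm z x) (ζ z) ∂m.1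

theorem stronglyMeasurable_adjoint {α : Type*} [MeasurableSpace α] {L : α → M d →L[ℝ] M d}
    (hL : Measurable L) : StronglyMeasurable fun x => ContinuousLinearMap.adjoint (L x) :=
  (ContinuousLinearMap.adjoint (𝕜 := ℝ) (E := M d) (F := M d)).continuous.comp_stronglyMeasurable
    hL.stronglyMeasurable

theorem norm_adjoint_apply_le {L : M d →L[ℝ] M d} {K : ℝ} (hL : ‖L‖ ≤ K) (v : M d) :
    ‖ContinuousLinearMap.adjoint L v‖ ≤ K * ‖v‖ := by
  refine (ContinuousLinearMap.le_opNorm _ _).trans ?_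
  rw [LinearIsometryEquiv.norm_map]
  exact mul_le_mul_of_nonneg_right hL (norm_nonneg _)

theorem stronglyMeasurable_clm_apply {α : Type*} [MeasurableSpace α] {L : α → M d →L[ℝ] M d}
    {h : α → M d} (hL : StronglyMeasurable L) (hh : StronglyMeasurable h) :
    StronglyMeasurable fun x => L x (h x) :=
  isBoundedBilinearMap_apply.continuous.comp_stronglyMeasurable (hL.prodMk hh)

theorem memLp_meanAdjoint {Amm : M d → M d → M d →L[ℝ] M d}
    (hmeas : Measurable (fun p : M d × M d => Amm p.1 p.2)) {K : ℝ} (hK : ∀ x a, ‖Amm x a‖ ≤ K)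
    {ζ : M d → M d} (hζ : Continuous ζ) {B : ℝ} (hB : ∀ x, ‖ζ x‖ ≤ B) :
    MemLp (meanAdjoint m Amm ζ) 2 m.1 := by
  have hK0 : 0 ≤ K := (norm_nonneg _).trans (hK 0 0)
  refine MemLp.of_bound ?_ (K * B) (.of_forall fun x => ?_)
  · have h1 : StronglyMeasurable (Function.uncurry fun (x z : M d) =>
        ContinuousLinearMap.adjoint (Amm z x) (ζ z)) :=
      stronglyMeasurable_clm_apply
        (stronglyMeasurable_adjoint (L := fun p : M d × M d => Amm p.2 p.1)
          (hmeas.comp measurable_swap)) (hζ.comp continuous_snd).stronglyMeasurable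
    exact (h1.integral_prod_right (ν := m.1)).aestronglyMeasurable
  · refine (norm_integral_le_of_norm_le_const (C := K * B) (.of_forall fun z => ?_)).trans_eq (by simp)
    exact (norm_adjoint_apply_le (hK z x) _).trans (mul_le_mul_of_nonneg_left (hB z) hK0)

theorem integrable_kernel_prod (h : γ ∈ plans m ν) {Amm : M d → M d → M d →L[ℝ] M d}
    (hmeas : Measurable (fun p : M d × M d => Amm p.1 p.2)) {K : ℝ} (hK : ∀ x a, ‖Amm x a‖ ≤ K)
    {ζ : M d → M d} (hζ : Continuous ζ) {B : ℝ} (hB : ∀ x, ‖ζ x‖ ≤ B) :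
    Integrable (fun q : M d × M d × M d => ⟪Amm q.1 q.2.1 (q.2.2 - q.2.1), ζ q.1⟫)
      (m.1.prod γ) := by
  have hprob := isProbabilityMeasure_of_mem_plans h
  have hK0 : 0 ≤ K := (norm_nonneg _).trans (hK 0 0)
  have h1 : Integrable (fun p : M d × M d => p.2 - p.1) γ :=
    (memLp_displacement h).integrable one_le_two
  have h2 : Integrable (fun q : M d × M d × M d => K * ‖q.2.2 - q.2.1‖ * B) (m.1.prod γ) :=
    ((h1.norm.comp_snd m.1).const_mul K).mul_const B
  refine h2.mono' ?_ (.of_forall fun q => ?_)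
  · refine StronglyMeasurable.aestronglyMeasurable (StronglyMeasurable.inner ?_ ?_)
    · refine stronglyMeasurable_clm_apply (Measurable.stronglyMeasurable ?_) ?_
      · exact hmeas.comp (measurable_fst.prodMk (measurable_fst.comp measurable_snd))
      · exact Continuous.stronglyMeasurable (by fun_prop)
    · exact (hζ.comp continuous_fst).stronglyMeasurable
  · refine (norm_inner_le_norm _ _).trans (mul_le_mul ?_ (hB _) (norm_nonneg _) (by positivity))
    exact (ContinuousLinearMap.le_opNorm _ _).trans
      (mul_le_mul_of_nonneg_right (hK _ _) (norm_nonneg _))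

theorem integrable_kernel_displacement (h : γ ∈ plans m ν) {Amm : M d → M d → M d →L[ℝ] M d}
    (hmeas : Measurable (fun p : M d × M d => Amm p.1 p.2)) {K : ℝ} (hK : ∀ x a, ‖Amm x a‖ ≤ K)
    (x : M d) : Integrable (fun p : M d × M d => Amm x p.1 (p.2 - p.1)) γ := by
  have hprob := isProbabilityMeasure_of_mem_plans h
  have h1 : Integrable (fun p : M d × M d => p.2 - p.1) γ :=
    (memLp_displacement h).integrable one_le_two
  refine (h1.norm.const_mul K).mono' ?_ (.of_forall fun p => ?_)
  · refine StronglyMeasurable.aestronglyMeasurable (stronglyMeasurable_clm_apply ?_ ?_)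
    · exact (hmeas.comp (measurable_const.prodMk measurable_fst)).stronglyMeasurable
    · exact Continuous.stronglyMeasurable (by fun_prop)
  · exact (ContinuousLinearMap.le_opNorm _ _).trans
      (mul_le_mul_of_nonneg_right (hK _ _) (norm_nonneg _))

theorem integrable_adjoint_kernel {Amm : M d → M d → M d →L[ℝ] M d}
    (hmeas : Measurable (fun p : M d × M d => Amm p.1 p.2)) {K : ℝ} (hK : ∀ x a, ‖Amm x a‖ ≤ K)
    {ζ : M d → M d} (hζ : Continuous ζ) {B : ℝ} (hB : ∀ x, ‖ζ x‖ ≤ B) (a : M d) :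
    Integrable (fun z => ContinuousLinearMap.adjoint (Amm z a) (ζ z)) m.1 := by
  have hK0 : 0 ≤ K := (norm_nonneg _).trans (hK 0 0)
  refine Integrable.of_bound (C := K * B) ?_ (.of_forall fun z => ?_)
  · refine StronglyMeasurable.aestronglyMeasurable (stronglyMeasurable_clm_apply ?_
      hζ.stronglyMeasurable)
    exact stronglyMeasurable_adjoint (hmeas.comp (measurable_id.prodMk measurable_const))
  · exact (norm_adjoint_apply_le (hK z a) _).trans (mul_le_mul_of_nonneg_left (hB z) hK0)

/-- Fubini turns the nonlocal term of the expansion into a pairing of one fixed field with the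
displacement, as a gradient must be. -/
theorem integral_inner_kernel_displacement (h : γ ∈ plans m ν)
    {Amm : M d → M d → M d →L[ℝ] M d}
    (hmeas : Measurable (fun p : M d × M d => Amm p.1 p.2)) {K : ℝ} (hK : ∀ x a, ‖Amm x a‖ ≤ K)
    {ζ : M d → M d} (hζ : Continuous ζ) {B : ℝ} (hB : ∀ x, ‖ζ x‖ ≤ B) :
    ∫ x, ⟪∫ p, Amm x p.1 (p.2 - p.1) ∂γ, ζ x⟫ ∂m.1 =
      ∫ p, ⟪meanAdjoint m Amm ζ p.1, p.2 - p.1⟫ ∂γ := by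
  have hprob := isProbabilityMeasure_of_mem_plans h
  have h1 : ∀ x, ⟪∫ p, Amm x p.1 (p.2 - p.1) ∂γ, ζ x⟫ =
      ∫ p, ⟪Amm x p.1 (p.2 - p.1), ζ x⟫ ∂γ := fun x => by
    rw [real_inner_comm, ← integral_inner (integrable_kernel_displacement h hmeas hK x)]
    simp_rw [real_inner_comm]
  simp_rw [h1]
  rw [integral_integral_swap (integrable_kernel_prod h hmeas hK hζ hB)]
  refine integral_congr_ae (.of_forall fun p => ?_)
  dsimp only
  rw [meanAdjoint, real_inner_comm, ← integral_inner
    (integrable_adjoint_kernel hmeas hK hζ hB p.1)]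
  refine integral_congr_ae (.of_forall fun z => ?_)
  dsimp only
  rw [ContinuousLinearMap.adjoint_inner_right]

/-- The gradient at `m` of `ν ↦ ζ · (U[ν])`. -/
noncomputable def dirDerivGradient (m : P2 d) (a : M d → M d) (At : M d → M d →L[ℝ] M d)
    (Amm : M d → M d → M d →L[ℝ] M d) (ζ : M d → M d) (x : M d) : M d :=
  ContinuousLinearMap.adjoint (fderiv ℝ ζ x) (a x) + ContinuousLinearMap.adjoint (At x) (ζ x) +
    meanAdjoint m Amm ζ x

theorem memLp_localAdjoint {a : M d → M d} (ha : Continuous a) {At : M d → M d →L[ℝ] M d}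
    (hAt : Measurable At) {K : ℝ} (hK : ∀ x, ‖At x‖ ≤ K) {ζ : M d → M d}
    (hζ : ContDiff ℝ ∞ ζ) (hs : HasCompactSupport ζ) :
    MemLp (fun x => ContinuousLinearMap.adjoint (fderiv ℝ ζ x) (a x) +
      ContinuousLinearMap.adjoint (At x) (ζ x)) 2 m.1 := by
  have hK0 : 0 ≤ K := (norm_nonneg _).trans (hK 0)
  obtain ⟨B, hB⟩ := hs.exists_bound_of_continuous hζ.continuous
  refine MemLp.add ?_ ?_
  · refine Continuous.memLp_of_hasCompactSupport ?_ ?_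
    · refine isBoundedBilinearMap_apply.continuous.comp (Continuous.prodMk ?_ ha)
      exact (ContinuousLinearMap.adjoint (𝕜 := ℝ) (E := M d) (F := M d)).continuous.comp
        (hζ.continuous_fderiv (by simp))
    · refine (hs.fderiv (𝕜 := ℝ)).mono fun x hx hx' => hx ?_
      simp only [hx', map_zero, zero_apply]
  · refine MemLp.of_bound ?_ (K * B) (.of_forall fun x => ?_)
    · exact (stronglyMeasurable_clm_apply (stronglyMeasurable_adjoint hAt)
        hζ.continuous.stronglyMeasurable).aestronglyMeasurable
    · exact (norm_adjoint_apply_le (hK x) _).trans (mul_le_mul_of_nonneg_left (hB x) hK0)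

theorem memLp_dirDerivGradient {a : M d → M d} (ha : Continuous a) {At : M d → M d →L[ℝ] M d}
    (hAt : Measurable At) {K : ℝ} (hK : ∀ x, ‖At x‖ ≤ K) {Amm : M d → M d → M d →L[ℝ] M d}
    (hmeas : Measurable (fun p : M d × M d => Amm p.1 p.2)) {K' : ℝ}
    (hK' : ∀ x a, ‖Amm x a‖ ≤ K') {ζ : M d → M d}
    (hζ : ContDiff ℝ ∞ ζ) (hs : HasCompactSupport ζ) :
    MemLp (dirDerivGradient m a At Amm ζ) 2 m.1 := by
  obtain ⟨B, hB⟩ := hs.exists_bound_of_continuous hζ.continuous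
  exact (memLp_localAdjoint ha hAt hK hζ hs).add (memLp_meanAdjoint hmeas hK' hζ.continuous hB)

/-- If the gradients `A ν` of a function have a first order expansion in `ν`, then so has their
pairing with a test field. -/
theorem isStrongGradient_of_expansion {F : P2 d → ℝ} {r : ℝ} (hr : 0 < r)
    {A : P2 d → M d → M d} {ζ : M d → M d} (hζ : ContDiff ℝ ∞ ζ) (hs : HasCompactSupport ζ)
    (hA : ∀ ν : P2 d, W2 m ν < r → Continuous (A ν))
    (hF : ∀ ν : P2 d, W2 m ν < r → F ν = ∫ x, ⟪A ν x, ζ x⟫ ∂ν.1)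
    {Cm : ℝ} (hgrowth : ∀ x, ‖A m x‖ ≤ Cm * (1 + ‖x‖))
    {ρ ε₂ : ℝ → ℝ} (hρ_nonneg : ∀ t, 0 ≤ t → 0 ≤ ρ t)
    (hρ_lim : Tendsto ρ (𝓝[>] 0) (𝓝 0)) (hε_lim : Tendsto ε₂ (𝓝[>] 0) (𝓝 0))
    (hρ0 : ρ 0 = 0) (hρ_concave : ConcaveOn ℝ (Ici 0) ρ)
    {At : M d → M d →L[ℝ] M d} (hAt_meas : Measurable At) {K : ℝ} (hK : ∀ x, ‖At x‖ ≤ K)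
    {Amm : M d → M d → M d →L[ℝ] M d}
    (hmeas : Measurable (fun p : M d × M d => Amm p.1 p.2)) {K' : ℝ}
    (hK' : ∀ x a, ‖Amm x a‖ ≤ K')
    (hexp : ∀ ν : P2 d, W2 m ν < r → ∀ γ ∈ optPlans m ν, ∀ x y : M d,
      ‖A ν y - A m x - expansion At Amm γ x y‖ ≤
        ‖x - y‖ * ρ ‖x - y‖ + W2 m ν * ε₂ (W2 m ν)) :
    IsStrongGradient F m (dirDerivGradient m (A m) At Amm ζ) := by
  have hK0 : 0 ≤ K := (norm_nonneg _).trans (hK 0)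
  have hK0' : 0 ≤ K' := (norm_nonneg _).trans (hK' 0 0)
  have hmm : W2 m m < r := by rw [W2_self]; exact hr
  obtain ⟨B, hB⟩ := hs.exists_bound_of_continuous hζ.continuous
  have hB0 : 0 ≤ B := (norm_nonneg _).trans (hB 0)
  obtain ⟨L, hL⟩ := ContDiff.lipschitzWith_of_hasCompactSupport hs hζ (by simp)
  obtain ⟨Q, hQ0, hQ⟩ := exists_quadratic_bound hζ hs hgrowth
  intro ε hε
  -- The final error is `2BηW + CW²`: one `Bη` from `ρ`, one from `ε₂`, and all quadratic terms in
  -- `C`. Each of the three parts is kept below `εW / 3`.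
  set η : ℝ := ε / (3 * (B + 1)) with hη
  have hη0 : 0 < η := by positivity
  have hηB : B * η ≤ ε / 3 := by
    have h : (B + 1) * η = ε / 3 := by rw [hη]; field_simp
    linarith
  obtain ⟨κ, hκ0, hκ⟩ := exists_affine_bound hρ_lim hρ0 hρ_nonneg hρ_concave hη0
  obtain ⟨δ₁, hδ₁, hsub⟩ := mem_nhdsGT_iff_exists_Ioo_subset.1
    (hε_lim.eventually (gt_mem_nhds hη0) : {s | ε₂ s < η} ∈ 𝓝[>] (0 : ℝ))
  have hδ₁0 : 0 < δ₁ := hδ₁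
  set C : ℝ := B * κ + L * K + L * K' + Q with hC
  have hC0 : 0 ≤ C := by positivity
  refine ⟨min r (min δ₁ (ε / (3 * (C + 1)))), by positivity, fun ν hν γ hγ => ?_⟩
  set W := W2 m ν with hW
  have hW0 : 0 ≤ W := W2_nonneg m ν
  have hWr : W < r := hν.trans_le (min_le_left _ _)
  have hWδ : W < δ₁ := hν.trans_le ((min_le_right _ _).trans (min_le_left _ _))
  have hWC : C * W ≤ ε / 3 := by
    have h1 : W < ε / (3 * (C + 1)) := hν.trans_le ((min_le_right _ _).trans (min_le_right _ _))
    rw [lt_div_iff₀ (by positivity)] at h1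
    nlinarith
  -- Nothing is known about `ε₂ 0`, but there the factor `W` vanishes.
  have hWε : W * ε₂ W ≤ W * η := by
    rcases hW0.eq_or_lt with h | h
    · rw [← h, zero_mul, zero_mul]
    · exact mul_le_mul_of_nonneg_left (le_of_lt (hsub ⟨h, hWδ⟩)) hW0
  have hprob := isProbabilityMeasure_of_mem_plans hγ.1
  have hD := memLp_displacement hγ.1
  have hDW := lpNorm_displacement hγ
  have hD1 : ∫ p : M d × M d, ‖p.2 - p.1‖ ∂γ ≤ W :=
    (integral_norm_le_lpNorm hD).trans_eq hDW
  have hD2 : ∫ p : M d × M d, ‖p.2 - p.1‖ ^ 2 ∂γ = W ^ 2 := by rw [← lpNorm_two_sq hD, hDW]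
  have hDi1 : Integrable (fun p : M d × M d => ‖p.2 - p.1‖) γ := (hD.integrable one_le_two).norm
  have hDi2 : Integrable (fun p : M d × M d => ‖p.2 - p.1‖ ^ 2) γ :=
    hD.integrable_norm_pow (by norm_num)
  set b : M d → M d := fun x => ∫ p, Amm x p.1 (p.2 - p.1) ∂γ with hb
  have hbK : ∀ x, ‖b x‖ ≤ K' * W := fun x => by
    refine (norm_integral_le_of_norm_le (hDi1.const_mul K') (.of_forall fun p => ?_)).trans ?_
    · exact (ContinuousLinearMap.le_opNorm _ _).trans
        (mul_le_mul_of_nonneg_right (hK' _ _) (norm_nonneg _))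
    · rw [integral_const_mul]
      exact mul_le_mul_of_nonneg_left hD1 hK0'
  set g : M d → M d := fun x => ContinuousLinearMap.adjoint (fderiv ℝ ζ x) (A m x) +
    ContinuousLinearMap.adjoint (At x) (ζ x) with hg
  have hgL : MemLp g 2 m.1 := memLp_localAdjoint (hA m hmm) hAt_meas hK hζ hs
  have hpt : ∀ p : M d × M d, ‖⟪A ν p.2, ζ p.2⟫ - ⟪A m p.1, ζ p.1⟫ - ⟪g p.1, p.2 - p.1⟫ -
      ⟪b p.1, ζ p.1⟫‖ ≤ (B * η + L * K' * W) * ‖p.2 - p.1‖ +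
        (B * κ + L * K + Q) * ‖p.2 - p.1‖ ^ 2 + B * (W * η) := by
    rintro ⟨x, y⟩
    dsimp only
    set D := ‖y - x‖ with hDdef
    have hD0 : 0 ≤ D := norm_nonneg _
    set e : M d := expansion At Amm γ x y with he
    have he' : e = At x (y - x) + b x := rfl
    -- The product rule: the error of the expansion meets `ζ y`, the expansion itself meets the
    -- increment of `ζ`, and `A m x` meets the Taylor remainder of `ζ`. The last two are quadratic
    -- in the displacement and `W`.
    have hdecomp : ⟪A ν y, ζ y⟫ - ⟪A m x, ζ x⟫ - ⟪g x, y - x⟫ - ⟪b x, ζ x⟫ =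
        ⟪A ν y - A m x - e, ζ y⟫ + ⟪e, ζ y - ζ x⟫ +
          ⟪A m x, ζ y - ζ x - fderiv ℝ ζ x (y - x)⟫ := by
      have h1 : ⟪g x, y - x⟫ = ⟪A m x, fderiv ℝ ζ x (y - x)⟫ + ⟪At x (y - x), ζ x⟫ := by
        rw [hg]
        dsimp only
        rw [inner_add_left, ContinuousLinearMap.adjoint_inner_left,
          ContinuousLinearMap.adjoint_inner_left, real_inner_comm (ζ x)]
      have h2 : ⟪e, ζ x⟫ = ⟪At x (y - x), ζ x⟫ + ⟪b x, ζ x⟫ := by rw [he', inner_add_left]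
      simp only [h1, inner_sub_left, inner_sub_right, h2]
      ring
    have hT1 : ‖⟪A ν y - A m x - e, ζ y⟫‖ ≤ (D * (η + κ * D) + W * η) * B := by
      refine (norm_inner_le_norm _ _).trans (mul_le_mul ?_ (hB y) (norm_nonneg _) (by positivity))
      refine (hexp ν hWr γ hγ x y).trans (add_le_add ?_ hWε)
      rw [norm_sub_rev x y]
      exact mul_le_mul_of_nonneg_left (hκ _ hD0) hD0
    have hT2 : ‖⟪e, ζ y - ζ x⟫‖ ≤ (K * D + K' * W) * (L * D) := by
      refine (norm_inner_le_norm _ _).trans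
        (mul_le_mul ?_ (hL.norm_sub_le y x) (norm_nonneg _) (by positivity))
      rw [he']
      refine (norm_add_le _ _).trans (add_le_add ?_ (hbK x))
      exact (ContinuousLinearMap.le_opNorm _ _).trans
        (mul_le_mul_of_nonneg_right (hK x) (norm_nonneg _))
    have hT3 : ‖⟪A m x, ζ y - ζ x - fderiv ℝ ζ x (y - x)⟫‖ ≤ Q * D ^ 2 :=
      (norm_inner_le_norm _ _).trans (hQ x y)
    rw [hdecomp]
    have h1 := norm_add₃_le (a := ⟪A ν y - A m x - e, ζ y⟫) (b := ⟪e, ζ y - ζ x⟫)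
      (c := ⟪A m x, ζ y - ζ x - fderiv ℝ ζ x (y - x)⟫)
    refine h1.trans ((add_le_add (add_le_add hT1 hT2) hT3).trans_eq ?_)
    ring
  have hcomp : ∀ {f : M d → M d}, Continuous f → Continuous (fun x => ⟪f x, ζ x⟫) ∧
      HasCompactSupport (fun x => ⟪f x, ζ x⟫) := fun {f} hf =>
    ⟨hf.inner hζ.continuous, hs.mono fun x hx hx' => hx (by
      simp only [hx', inner_zero_right])⟩
  have hi1 : Integrable (fun p : M d × M d => ⟪A ν p.2, ζ p.2⟫) γ :=
    (measurePreserving_snd_of_mem_plans hγ.1).integrable_comp_of_integrable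
      ((hcomp (hA ν hWr)).1.integrable_of_hasCompactSupport (hcomp (hA ν hWr)).2)
  have hi2 : Integrable (fun p : M d × M d => ⟪A m p.1, ζ p.1⟫) γ :=
    (measurePreserving_fst_of_mem_plans hγ.1).integrable_comp_of_integrable
      ((hcomp (hA m hmm)).1.integrable_of_hasCompactSupport (hcomp (hA m hmm)).2)
  have hi3 : Integrable (fun p : M d × M d => ⟪g p.1, p.2 - p.1⟫) γ :=
    integrable_inner_of_memLp (memLp_comp_fst hγ.1 hgL) hD
  have hbi : Integrable (fun x => ⟪b x, ζ x⟫) m.1 := by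
    refine (integrable_kernel_prod hγ.1 hmeas hK' hζ.continuous hB).integral_prod_left.congr
      (.of_forall fun x => ?_)
    dsimp only
    rw [hb, real_inner_comm,
      ← integral_inner (integrable_kernel_displacement hγ.1 hmeas hK' x)]
    simp_rw [real_inner_comm]
  have hi4 : Integrable (fun p : M d × M d => ⟪b p.1, ζ p.1⟫) γ :=
    (measurePreserving_fst_of_mem_plans hγ.1).integrable_comp_of_integrable hbi
  have hi12 : Integrable (fun p : M d × M d => ⟪A ν p.2, ζ p.2⟫ - ⟪A m p.1, ζ p.1⟫) γ := hi1.sub hi2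
  have hi123 : Integrable (fun p : M d × M d =>
      ⟪A ν p.2, ζ p.2⟫ - ⟪A m p.1, ζ p.1⟫ - ⟪g p.1, p.2 - p.1⟫) γ := hi12.sub hi3
  have hmean : MemLp (meanAdjoint m Amm ζ) 2 m.1 := memLp_meanAdjoint hmeas hK' hζ.continuous hB
  have hlhs : ∫ p : M d × M d, (⟪A ν p.2, ζ p.2⟫ - ⟪A m p.1, ζ p.1⟫ - ⟪g p.1, p.2 - p.1⟫ -
      ⟪b p.1, ζ p.1⟫) ∂γ =
      F ν - F m - ∫ p, ⟪dirDerivGradient m (A m) At Amm ζ p.1, p.2 - p.1⟫ ∂γ := by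
    have h1 : ∫ p, ⟪dirDerivGradient m (A m) At Amm ζ p.1, p.2 - p.1⟫ ∂γ =
        ∫ p, ⟪g p.1, p.2 - p.1⟫ ∂γ + ∫ p, ⟪meanAdjoint m Amm ζ p.1, p.2 - p.1⟫ ∂γ := by
      rw [← integral_add hi3 (integrable_inner_of_memLp (memLp_comp_fst hγ.1 hmean) hD)]
      refine integral_congr_ae (.of_forall fun p => ?_)
      dsimp only
      rw [← inner_add_left]
      rfl
    rw [h1, ← integral_inner_kernel_displacement hγ.1 hmeas hK' hζ.continuous hB,
      hF ν hWr, hF m hmm,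
      ← integral_comp_fst hγ.1 (f := fun x => ⟪b x, ζ x⟫) hbi.aestronglyMeasurable,
      ← integral_comp_fst hγ.1 (f := fun x => ⟪A m x, ζ x⟫)
        (hcomp (hA m hmm)).1.aestronglyMeasurable,
      ← integral_comp_snd hγ.1 (f := fun x => ⟪A ν x, ζ x⟫)
        (hcomp (hA ν hWr)).1.aestronglyMeasurable,
      integral_sub hi123 hi4, integral_sub hi12 hi3,
      integral_sub hi1 hi2]
    ring
  have hj1 : Integrable (fun p : M d × M d => (B * η + L * K' * W) * ‖p.2 - p.1‖) γ :=
    hDi1.const_mul _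
  have hj2 : Integrable (fun p : M d × M d => (B * κ + L * K + Q) * ‖p.2 - p.1‖ ^ 2) γ :=
    hDi2.const_mul _
  have hj12 : Integrable (fun p : M d × M d => (B * η + L * K' * W) * ‖p.2 - p.1‖ +
      (B * κ + L * K + Q) * ‖p.2 - p.1‖ ^ 2) γ := hj1.add hj2
  have hle := norm_integral_le_of_norm_le (hj12.add (integrable_const (B * (W * η))))
    (.of_forall hpt)
  rw [← Real.norm_eq_abs, ← hlhs]
  refine hle.trans ?_
  have hrhs : ∫ p : M d × M d, ((B * η + L * K' * W) * ‖p.2 - p.1‖ +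
        (B * κ + L * K + Q) * ‖p.2 - p.1‖ ^ 2 + B * (W * η)) ∂γ =
      (B * η + L * K' * W) * ∫ p : M d × M d, ‖p.2 - p.1‖ ∂γ +
        (B * κ + L * K + Q) * W ^ 2 + B * (W * η) := by
    rw [integral_add hj12 (integrable_const _), integral_add hj1 hj2,
      integral_const_mul, integral_const_mul, hD2]
    simp
  refine hrhs.trans_le ?_
  have h1 : (B * η + L * K' * W) * ∫ p : M d × M d, ‖p.2 - p.1‖ ∂γ ≤
      (B * η + L * K' * W) * W := mul_le_mul_of_nonneg_left hD1 (by positivity)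
  have h2 := mul_le_mul_of_nonneg_right hηB hW0
  have h3 := mul_le_mul_of_nonneg_right hWC hW0
  rw [hC] at h3
  linarith

/-! ### The bounded bilinear form -/

section Pairing

variable {α : Type*} [MeasurableSpace α] {μ : Measure α} {L : α → M d →L[ℝ] M d} {K : ℝ}
  {f f' g g' : α → M d}

theorem memLp_clm_apply (hL : Measurable L) (hK : ∀ x, ‖L x‖ ≤ K) (hf : MemLp f 2 μ) :
    MemLp (fun x => L x (f x)) 2 μ := by
  refine MemLp.of_le_mul (c := K) hf
    (aestronglyMeasurable_clm_apply hL.stronglyMeasurable.aestronglyMeasurable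
      hf.aestronglyMeasurable) (.of_forall fun x => ?_)
  exact (ContinuousLinearMap.le_opNorm _ _).trans
    (mul_le_mul_of_nonneg_right (hK x) (norm_nonneg _))

theorem integral_pairing_add_left (hL : Measurable L) (hK : ∀ x, ‖L x‖ ≤ K)
    (hf : MemLp f 2 μ) (hf' : MemLp f' 2 μ) (hg : MemLp g 2 μ) {u : α → M d}
    (hu : u =ᵐ[μ] f + f') :
    ∫ x, ⟪L x (u x), g x⟫ ∂μ = ∫ x, ⟪L x (f x), g x⟫ ∂μ + ∫ x, ⟪L x (f' x), g x⟫ ∂μ := by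
  rw [← integral_add (integrable_inner_of_memLp (memLp_clm_apply hL hK hf) hg)
    (integrable_inner_of_memLp (memLp_clm_apply hL hK hf') hg)]
  refine integral_congr_ae ?_
  filter_upwards [hu] with x hx
  rw [hx, Pi.add_apply, map_add, inner_add_left]

theorem integral_pairing_add_right (hL : Measurable L) (hK : ∀ x, ‖L x‖ ≤ K)
    (hf : MemLp f 2 μ) (hg : MemLp g 2 μ) (hg' : MemLp g' 2 μ) {v : α → M d}
    (hv : v =ᵐ[μ] g + g') :
    ∫ x, ⟪L x (f x), v x⟫ ∂μ = ∫ x, ⟪L x (f x), g x⟫ ∂μ + ∫ x, ⟪L x (f x), g' x⟫ ∂μ := by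
  rw [← integral_add (integrable_inner_of_memLp (memLp_clm_apply hL hK hf) hg)
    (integrable_inner_of_memLp (memLp_clm_apply hL hK hf) hg')]
  refine integral_congr_ae ?_
  filter_upwards [hv] with x hx
  rw [hx, Pi.add_apply, inner_add_right]

theorem integral_pairing_smul_left (c : ℝ) {u : α → M d} (hu : u =ᵐ[μ] c • f) :
    ∫ x, ⟪L x (u x), g x⟫ ∂μ = c * ∫ x, ⟪L x (f x), g x⟫ ∂μ := by
  rw [← integral_const_mul]
  refine integral_congr_ae ?_
  filter_upwards [hu] with x hx
  rw [hx, Pi.smul_apply, map_smul, real_inner_smul_left]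

theorem integral_pairing_smul_right (c : ℝ) {v : α → M d} (hv : v =ᵐ[μ] c • g) :
    ∫ x, ⟪L x (f x), v x⟫ ∂μ = c * ∫ x, ⟪L x (f x), g x⟫ ∂μ := by
  rw [← integral_const_mul]
  refine integral_congr_ae ?_
  filter_upwards [hv] with x hx
  rw [hx, Pi.smul_apply, real_inner_smul_right]

theorem abs_integral_pairing_le (hK : ∀ x, ‖L x‖ ≤ K) (hK0 : 0 ≤ K)
    (hf : MemLp f 2 μ) (hg : MemLp g 2 μ) :
    |∫ x, ⟪L x (f x), g x⟫ ∂μ| ≤ K * (lpNorm f 2 μ * lpNorm g 2 μ) := by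
  rw [← Real.norm_eq_abs]
  refine (norm_integral_le_of_norm_le ((integrable_norm_mul_norm hf hg).const_mul K)
    (.of_forall fun x => ?_)).trans ?_
  · refine (norm_inner_le_norm _ _).trans ?_
    rw [← mul_assoc]
    exact mul_le_mul_of_nonneg_right ((ContinuousLinearMap.le_opNorm _ _).trans
      (mul_le_mul_of_nonneg_right (hK x) (norm_nonneg _))) (norm_nonneg _)
  · rw [integral_const_mul]
    exact mul_le_mul_of_nonneg_left (integral_norm_mul_norm_le hf hg) hK0

theorem lpNorm_comp_measurePreserving {T : α → M d} (hT : MeasurePreserving T μ m.1) (u : L2 m) :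
    lpNorm (fun x => u (T x)) 2 μ = ‖u‖ := by
  have hu := Lp.aestronglyMeasurable u
  rw [Lp.norm_def, ← eLpNorm_comp_measurePreserving hu hT,
    toReal_eLpNorm (hu.comp_measurePreserving hT)]
  rfl

theorem lpNorm_coe (u : L2 m) : lpNorm u 2 m.1 = ‖u‖ := by
  rw [Lp.norm_def, toReal_eLpNorm (Lp.aestronglyMeasurable u)]

end Pairing

/-- The bilinear form `∫ ⟨Ã u, v⟩ dm + ∫∫ ⟨A_{mm}(x, a) u(a), v(x)⟩ m(dx) m(da)`. -/
noncomputable def hessForm (m : P2 d) (At : M d → M d →L[ℝ] M d) (Amm : M d → M d → M d →L[ℝ] M d)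
    (u v : M d → M d) : ℝ :=
  (∫ x, ⟪At x (u x), v x⟫ ∂m.1) +
    ∫ p : M d × M d, ⟪Amm p.1 p.2 (u p.2), v p.1⟫ ∂(m.1.prod m.1)

theorem abs_hessForm_le {At : M d → M d →L[ℝ] M d} {K : ℝ} (hK : ∀ x, ‖At x‖ ≤ K)
    {Amm : M d → M d → M d →L[ℝ] M d} {K' : ℝ} (hK' : ∀ x a, ‖Amm x a‖ ≤ K') (u v : L2 m) :
    |hessForm m At Amm u v| ≤ (K + K') * ‖u‖ * ‖v‖ := by
  have h1 := measurePreserving_fst_of_mem_plans (prod_mem_plans m m)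
  have h2 := measurePreserving_snd_of_mem_plans (prod_mem_plans m m)
  have e1 := abs_integral_pairing_le hK ((norm_nonneg _).trans (hK 0)) (Lp.memLp u) (Lp.memLp v)
  have e2 := abs_integral_pairing_le (fun p : M d × M d => hK' p.1 p.2)
    ((norm_nonneg _).trans (hK' 0 0)) ((Lp.memLp u).comp_measurePreserving h2)
    ((Lp.memLp v).comp_measurePreserving h1)
  simp only [Function.comp_def, lpNorm_comp_measurePreserving h2,
    lpNorm_comp_measurePreserving h1] at e2
  rw [lpNorm_coe, lpNorm_coe] at e1
  refine (abs_add_le _ _).trans ((add_le_add e1 e2).trans_eq ?_)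
  ring

theorem exists_hessForm_clm (m : P2 d) {At : M d → M d →L[ℝ] M d} (hAt : Measurable At) {K : ℝ}
    (hK : ∀ x, ‖At x‖ ≤ K) {Amm : M d → M d → M d →L[ℝ] M d}
    (hAmm : Measurable (fun p : M d × M d => Amm p.1 p.2)) {K' : ℝ}
    (hK' : ∀ x a, ‖Amm x a‖ ≤ K') :
    ∃ H : tangent m →L[ℝ] tangent m →L[ℝ] ℝ, ∀ u v : tangent m,
      H u v = hessForm m At Amm (u : L2 m) (v : L2 m) := by
  have hK'' : ∀ p : M d × M d, ‖Amm p.1 p.2‖ ≤ K' := fun p => hK' p.1 p.2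
  have h1 := measurePreserving_fst_of_mem_plans (prod_mem_plans m m)
  have h2 := measurePreserving_snd_of_mem_plans (prod_mem_plans m m)
  have hm1 : ∀ u : L2 m, MemLp (fun p : M d × M d => u p.1) 2 (m.1.prod m.1) := fun u =>
    (Lp.memLp u).comp_measurePreserving h1
  have hm2 : ∀ u : L2 m, MemLp (fun p : M d × M d => u p.2) 2 (m.1.prod m.1) := fun u =>
    (Lp.memLp u).comp_measurePreserving h2
  refine ⟨LinearMap.mkContinuous₂ (LinearMap.mk₂ ℝ
    (fun u v : tangent m => hessForm m At Amm (u : L2 m) (v : L2 m)) ?_ ?_ ?_ ?_) (K + K') ?_,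
    fun u v => rfl⟩
  · intro u u' v
    have hu := Lp.coeFn_add (u : L2 m) (u' : L2 m)
    rw [hessForm, Submodule.coe_add, integral_pairing_add_left hAt hK (Lp.memLp _) (Lp.memLp _)
      (Lp.memLp _) hu, integral_pairing_add_left hAmm hK'' (hm2 u) (hm2 u') (hm1 v)
      (h2.quasiMeasurePreserving.ae hu), hessForm, hessForm]
    ring
  · intro c u v
    have hu := Lp.coeFn_smul c (u : L2 m)
    rw [hessForm, Submodule.coe_smul, integral_pairing_smul_left c hu,
      integral_pairing_smul_left (f := fun p : M d × M d => (u : L2 m) p.2) c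
      (h2.quasiMeasurePreserving.ae hu), hessForm, smul_eq_mul]
    ring
  · intro u v v'
    have hv := Lp.coeFn_add (v : L2 m) (v' : L2 m)
    rw [hessForm, Submodule.coe_add, integral_pairing_add_right hAt hK (Lp.memLp _) (Lp.memLp _)
      (Lp.memLp _) hv, integral_pairing_add_right hAmm hK'' (hm2 u) (hm1 v) (hm1 v')
      (h1.quasiMeasurePreserving.ae hv), hessForm, hessForm]
    ring
  · intro c u v
    have hv := Lp.coeFn_smul c (v : L2 m)
    rw [hessForm, Submodule.coe_smul, integral_pairing_smul_right c hv,
      integral_pairing_smul_right (g := fun p : M d × M d => (v : L2 m) p.1) c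
      (h1.quasiMeasurePreserving.ae hv), hessForm, smul_eq_mul]
    ring
  · intro u v
    exact abs_hessForm_le hK hK' (u : L2 m) (v : L2 m)

theorem hessForm_congr {At : M d → M d →L[ℝ] M d} {Amm : M d → M d → M d →L[ℝ] M d}
    {u u' v v' : M d → M d} (hu : u =ᵐ[m.1] u') (hv : v =ᵐ[m.1] v') :
    hessForm m At Amm u v = hessForm m At Amm u' v' := by
  have h1 := measurePreserving_fst_of_mem_plans (prod_mem_plans m m)
  have h2 := measurePreserving_snd_of_mem_plans (prod_mem_plans m m)
  unfold hessForm
  congr 1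
  · refine integral_congr_ae ?_
    filter_upwards [hu, hv] with x hx hx'
    rw [hx, hx']
  · refine integral_congr_ae ?_
    filter_upwards [h2.quasiMeasurePreserving.ae hu, h1.quasiMeasurePreserving.ae hv] with p hx hx'
    rw [hx, hx']

/-- Fubini again, now undoing the adjoint: the integration variable of `meanAdjoint` is the first
argument of the kernel, so `ζ₂` sits at `p.1` and `ζ₁` at `p.2`. -/
theorem integral_inner_meanAdjoint {Amm : M d → M d → M d →L[ℝ] M d}
    (hAmm : Measurable (fun p : M d × M d => Amm p.1 p.2)) {K : ℝ}
    (hK : ∀ x a, ‖Amm x a‖ ≤ K) {ζ₁ ζ₂ : M d → M d} (h₁ : MemLp ζ₁ 2 m.1) (h₂ : MemLp ζ₂ 2 m.1)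
    (hζ : Continuous ζ₂) {B : ℝ} (hB : ∀ x, ‖ζ₂ x‖ ≤ B) :
    ∫ x, ⟪meanAdjoint m Amm ζ₂ x, ζ₁ x⟫ ∂m.1 =
      ∫ p : M d × M d, ⟪Amm p.1 p.2 (ζ₁ p.2), ζ₂ p.1⟫ ∂(m.1.prod m.1) := by
  have e1 := measurePreserving_fst_of_mem_plans (prod_mem_plans m m)
  have e2 := measurePreserving_snd_of_mem_plans (prod_mem_plans m m)
  have hi : Integrable (fun p : M d × M d => ⟪Amm p.1 p.2 (ζ₁ p.2), ζ₂ p.1⟫) (m.1.prod m.1) :=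
    integrable_inner_of_memLp (memLp_clm_apply hAmm (fun p => hK p.1 p.2)
      (h₁.comp_measurePreserving e2)) (h₂.comp_measurePreserving e1)
  rw [integral_prod_symm _ hi]
  refine integral_congr_ae (.of_forall fun x => ?_)
  dsimp only
  rw [meanAdjoint, real_inner_comm, ← integral_inner
    (integrable_adjoint_kernel hAmm hK hζ hB x)]
  refine integral_congr_ae (.of_forall fun z => ?_)
  dsimp only
  rw [ContinuousLinearMap.adjoint_inner_right]

/-- The pairing of `dirDerivGradient` with a test field. -/
theorem integral_inner_dirDerivGradient {a : M d → M d} (ha : Continuous a)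
    {At : M d → M d →L[ℝ] M d} (hAt : Measurable At) {K : ℝ} (hK : ∀ x, ‖At x‖ ≤ K)
    {Amm : M d → M d → M d →L[ℝ] M d}
    (hAmm : Measurable (fun p : M d × M d => Amm p.1 p.2)) {K' : ℝ}
    (hK' : ∀ x a, ‖Amm x a‖ ≤ K') {ζ₁ ζ₂ : M d → M d} (hζ₁ : ContDiff ℝ ∞ ζ₁)
    (hs₁ : HasCompactSupport ζ₁) (hζ₂ : ContDiff ℝ ∞ ζ₂) (hs₂ : HasCompactSupport ζ₂) :
    ∫ x, ⟪dirDerivGradient m a At Amm ζ₂ x, ζ₁ x⟫ ∂m.1 =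
      ∫ x, ⟪a x, fderiv ℝ ζ₂ x (ζ₁ x)⟫ ∂m.1 + hessForm m At Amm ζ₁ ζ₂ := by
  obtain ⟨B, hB⟩ := hs₂.exists_bound_of_continuous hζ₂.continuous
  have h₁ : MemLp ζ₁ 2 m.1 := hζ₁.continuous.memLp_of_hasCompactSupport hs₁
  have h₂ : MemLp ζ₂ 2 m.1 := hζ₂.continuous.memLp_of_hasCompactSupport hs₂
  have hi1 : Integrable (fun x => ⟪a x, fderiv ℝ ζ₂ x (ζ₁ x)⟫) m.1 := by
    refine Continuous.integrable_of_hasCompactSupport (ha.inner ?_) (hs₁.mono fun x hx hx' => hx ?_)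
    · exact isBoundedBilinearMap_apply.continuous.comp
        ((hζ₂.continuous_fderiv (by simp)).prodMk hζ₁.continuous)
    · simp only [hx', map_zero, inner_zero_right]
  have hi2 : Integrable (fun x => ⟪At x (ζ₁ x), ζ₂ x⟫) m.1 :=
    integrable_inner_of_memLp (memLp_clm_apply hAt hK h₁) h₂
  have hi3 : Integrable (fun x => ⟪meanAdjoint m Amm ζ₂ x, ζ₁ x⟫) m.1 :=
    integrable_inner_of_memLp (memLp_meanAdjoint hAmm hK' hζ₂.continuous hB) h₁
  have hi12 : Integrable (fun x => ⟪a x, fderiv ℝ ζ₂ x (ζ₁ x)⟫ + ⟪At x (ζ₁ x), ζ₂ x⟫) m.1 :=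
    hi1.add hi2
  rw [hessForm, ← integral_inner_meanAdjoint hAmm hK' h₁ h₂ hζ₂.continuous hB, ← add_assoc,
    ← integral_add hi1 hi2, ← integral_add hi12 hi3]
  refine integral_congr_ae (.of_forall fun x => ?_)
  dsimp only [dirDerivGradient]
  rw [inner_add_left, inner_add_left, ContinuousLinearMap.adjoint_inner_left,
    ContinuousLinearMap.adjoint_inner_left, real_inner_comm (ζ₂ x)]

theorem ExtendsHessBar.hess_eq {U : P2 d → EReal} {H : tangent m →L[ℝ] tangent m →L[ℝ] ℝ}
    (hH : ExtendsHessBar U m H) : hess U m = H := by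
  have hex : ∃ H, ExtendsHessBar U m H := ⟨H, hH⟩
  rw [hess, dif_pos hex]
  exact hex.choose_spec.unique hH

end Wass

/-! ### The Hessian -/

theorem mainTheorem3 (d : ℕ) (U : Wass.P2 d → EReal) (m : Wass.P2 d)
    (r : ℝ) (hr : 0 < r)
    (hU : ∀ ν : Wass.P2 d, Wass.W2 m ν < r → Wass.DiffAt U ν)
    -- `A ν` is the continuous representative of the Wasserstein gradient at `ν`
    (A : Wass.P2 d → Wass.M d → Wass.M d)
    (hA : ∀ ν : Wass.P2 d, Wass.W2 m ν < r →
      Continuous (A ν) ∧ A ν =ᵐ[ν.1] (Wass.wGrad U ν : Wass.M d → Wass.M d))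
    (Cm : ℝ)
    (hgrowth : ∀ ν : Wass.P2 d, Wass.W2 m ν < r → ∀ x, ‖A ν x‖ ≤ Cm * (1 + ‖x‖))
    (ρ ε₂ : ℝ → ℝ)
    (hρ_nonneg : ∀ t, 0 ≤ t → 0 ≤ ρ t) (hε_nonneg : ∀ t, 0 ≤ t → 0 ≤ ε₂ t)
    (hρ_lim : Tendsto ρ (𝓝[>] 0) (𝓝 0)) (hε_lim : Tendsto ε₂ (𝓝[>] 0) (𝓝 0))
    (hρ_modulus : Wass.IsModulus ρ) (hρ_concave : ConcaveOn ℝ (Ici 0) ρ)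
    (At : Wass.M d → Wass.M d →L[ℝ] Wass.M d)
    (hAt_meas : Measurable At) (hAt_bdd : ∃ K : ℝ, ∀ x, ‖At x‖ ≤ K)
    (Amm : Wass.M d → Wass.M d → Wass.M d →L[ℝ] Wass.M d)
    (hAmm_meas : Measurable (fun p : Wass.M d × Wass.M d => Amm p.1 p.2))
    (hAmm_bdd : ∃ K : ℝ, ∀ x a, ‖Amm x a‖ ≤ K)
    (hexp : ∀ ν : Wass.P2 d, Wass.W2 m ν < r → ∀ γ ∈ Wass.optPlans m ν, ∀ x y : Wass.M d,
      ‖A ν y - A m x - Wass.expansion At Amm γ x y‖ ≤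
        ‖x - y‖ * ρ ‖x - y‖ + Wass.W2 m ν * ε₂ (Wass.W2 m ν)) :
    Wass.HasHessianAt U m ∧ Wass.ExtendsHessBar U m (Wass.hess U m) ∧
      ∀ ζ₁ ζ₂ : Wass.tangent m,
        Wass.hess U m ζ₁ ζ₂ =
          (∫ x, ⟪At x ((ζ₁ : Wass.L2 m) x), (ζ₂ : Wass.L2 m) x⟫ ∂m.1) +
          ∫ p : Wass.M d × Wass.M d,
            ⟪Amm p.1 p.2 ((ζ₁ : Wass.L2 m) p.2), (ζ₂ : Wass.L2 m) p.1⟫ ∂(m.1.prod m.1) := by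
  obtain ⟨K, hK⟩ := hAt_bdd
  obtain ⟨K', hK'⟩ := hAmm_bdd
  have hmm : Wass.W2 m m < r := by rw [Wass.W2_self]; exact hr
  -- The gradient passes to its class in `L²(m)`, where it can be compared with subgradients and
  -- projected. The values of `F` are computed with `A ν`, which equals the Wasserstein gradient
  -- `ν`-almost everywhere.
  have hstrong : ∀ (ζ : Wass.M d → Wass.M d) (hζ : ContDiff ℝ ∞ ζ) (hs : HasCompactSupport ζ),
      Wass.IsStrongGradient (Wass.dirDeriv U ζ) m ((Wass.memLp_dirDerivGradient (m := m)
        (hA m hmm).1 hAt_meas hK hAmm_meas hK' hζ hs).toLp) := by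
    intro ζ hζ hs
    refine (Wass.isStrongGradient_of_expansion hr hζ hs (fun ν hν => (hA ν hν).1)
      (fun ν hν => ?_) (hgrowth m hmm) hρ_nonneg hρ_lim hε_lim hρ_modulus.map_zero hρ_concave
      hAt_meas hK hAmm_meas hK' hexp).congr (MemLp.coeFn_toLp _).symm
    refine integral_congr_ae ?_
    filter_upwards [(hA ν hν).2] with x hx
    rw [hx]
  have hbar : ∀ φ₁ φ₂ : Wass.TestFn d, Wass.hessBar U m (∇ φ₁.1) (∇ φ₂.1) =
      Wass.hessForm m At Amm (Wass.gradL2 m φ₁) (Wass.gradL2 m φ₂) := by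
    intro φ₁ φ₂
    have hc₁ := Wass.contDiff_gradient φ₁
    have hc₂ := Wass.contDiff_gradient φ₂
    have hs₁ := Wass.hasCompactSupport_gradient φ₁
    have hs₂ := Wass.hasCompactSupport_gradient φ₂
    have h1 : Wass.dirDeriv (Wass.dirDerivFun U (∇ φ₂.1)) (∇ φ₁.1) m =
        ∫ x, ⟪Wass.dirDerivGradient m (A m) At Amm (∇ φ₂.1) x, ∇ φ₁.1 x⟫ ∂m.1 := by
      refine ((hstrong _ hc₂ hs₂).dirDeriv_gradient φ₁).trans (integral_congr_ae ?_)
      filter_upwards [(Wass.memLp_dirDerivGradient (m := m) (hA m hmm).1 hAt_meas hK hAmm_meas hK'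
        hc₂ hs₂).coeFn_toLp] with x hx
      rw [hx]
    -- The field `∇ζ₂ ζ₁` need not be a gradient; this term is read off from `A m` and cancels the
    -- first term of the pairing.
    have h2 : Wass.dirDeriv U (fun x => fderiv ℝ (∇ φ₂.1) x (∇ φ₁.1 x)) m =
        ∫ x, ⟪A m x, fderiv ℝ (∇ φ₂.1) x (∇ φ₁.1 x)⟫ ∂m.1 := by
      refine integral_congr_ae ?_
      filter_upwards [(hA m hmm).2] with x hx
      rw [hx]
    rw [Wass.hessBar, h1, h2, Wass.integral_inner_dirDerivGradient (hA m hmm).1 hAt_meas hK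
      hAmm_meas hK' hc₁ hs₁ hc₂ hs₂, add_sub_cancel_left]
    exact Wass.hessForm_congr (MemLp.coeFn_toLp _).symm (MemLp.coeFn_toLp _).symm
  obtain ⟨H, hH⟩ := Wass.exists_hessForm_clm m hAt_meas hK hAmm_meas hK'
  have hext : Wass.ExtendsHessBar U m H := fun φ₁ φ₂ => by rw [hbar, hH]; rfl
  have heq := hext.hess_eq
  refine ⟨⟨⟨r, hr, hU⟩, fun ζ hζ hs => (hstrong ζ hζ hs).diffAt, K + K', fun φ₁ φ₂ => ?_⟩,
    heq ▸ hext, fun ζ₁ ζ₂ => ?_⟩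
  · rw [hbar]
    exact Wass.abs_hessForm_le hK hK' _ _
  · rw [heq, hH]
    rfl
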